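/- Let $G=(V,E)$ be a finite simple undirected graph with $n=|V|$ and $m=|E|$, and let $s,t\in V$. An $s$–$t$ path is a simple path from $s$ to $t$. A set $T\subseteq V$ is a tracking set for $(G,s,t)$ if, for any two distinct $s$–$t$ paths $P_1,P_2$, the sequence of vertices of $T$ in the order in which they occur on $P_1$ differs from the corresponding sequence for $P_2$. The problem Tracking Paths asks for a tracking set of minimum cardinality. $G$ is chordal if every cycle of length greater than $3$ has a chord, i.e. an edge of $G$ that joins two vertices of the cycle and is not an edge of the cycle. Let $H$ be the reduced graph, obtained from $G$ by deleting every vertex and every edge that lies on no $s$–$t$ path of $G$. Let $M(G,s,t)$ be the set of all vertices $x$ for which there is an edge $ab$ of $H$ such that $x$ is adjacent in $H$ to both $a$ and $b$, and $ab$ lies on some $s$–$t$ path of $H-x$. Theorem. (1) If $G$ is chordal, then $M(G,s,t)$ is a minimum-cardinality tracking set for $(G,s,t)$. (2) Tracking Paths is solvable in polynomial time on chordal graphs: there are a fixed random access machine program and constants $c,C$ such that, for every chordal graph $G$ on the vertex set $\{0,\dots,n-1\}$ and all vertices $s,t$, the program, given $n,s,t$ and the adjacency matrix of $G$ in memory,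 halts after at most $C\,(n^2+m\,n^3)$ steps, and after at most $C\,m\,n^3$ steps if $m\ge 1$, and returns the set $M(G,s,t)$, which is a minimum-cardinality tracking set. Each elementary operation (constants, variable and array access, addition, truncated subtraction, multiplication, comparison, assignment, test) costs one step, and all values computed are smaller than $(n+2)^c$, i.e. machine words have $O(\log n)$ bits. -/

import Mathlib

namespace TrackingPaths

section Graphs

variable {V : Type*}

/-- A graph is chordal if every cycle of length greater than three has a chord, that is, an edge
of the graph between two vertices of the cycle that is not an edge of the cycle. -/
def IsChordal (G : SimpleGraph V) : Prop :=
  ∀ (v : V) (c : G.Walk v v), c.IsCycle → 3 < c.length →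
    ∃ a ∈ c.support, ∃ b ∈ c.support, G.Adj a b ∧ s(a, b) ∉ c.edges

open Classical in
/-- The sequence of the vertices of `T` in the order in which they occur on the path `p`. -/
noncomputable def trackerSequence {G : SimpleGraph V} {s t : V} (T : Set V) (p : G.Path s t) :
    List V :=
  p.1.support.filter (fun v => decide (v ∈ T))

/-- `T` is a tracking set if distinct simple `s`-`t` paths have distinct tracker sequences. -/
def IsTrackingSet (G : SimpleGraph V) (s t : V) (T : Set V) : Prop :=
  ∀ p q : G.Path s t, p ≠ q → trackerSequence T p ≠ trackerSequence T q

/-- A tracking set of minimum cardinality (used for finite graphs only). -/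
def IsMinimumTrackingSet (G : SimpleGraph V) (s t : V) (T : Set V) : Prop :=
  IsTrackingSet G s t T ∧ ∀ T' : Set V, IsTrackingSet G s t T' → T.ncard ≤ T'.ncard

/-- The result of the reduction rule: every vertex and every edge that lies on no `s`-`t` path
is deleted. -/
def reducedGraph (G : SimpleGraph V) (s t : V) : G.Subgraph where
  verts := {v | ∃ p : G.Path s t, v ∈ p.1.support}
  Adj a b := ∃ p : G.Path s t, s(a, b) ∈ p.1.edges
  adj_sub := by
    rintro a b ⟨p, hp⟩
    exact p.1.adj_of_mem_edges hp
  edge_vert := by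
    rintro a b ⟨p, hp⟩
    exact ⟨p, p.1.fst_mem_support_of_mem_edges hp⟩
  symm := ⟨by
    rintro a b ⟨p, hp⟩
    exact ⟨p, by rwa [Sym2.eq_swap]⟩⟩

/-- The set marked by the algorithm. In the reduced graph `H`, a vertex `x` is marked if it is a
common neighbour of the ends of an edge `ab` of `H` that lies on some `s`-`t` path of `H - x`
(equivalently, on some `s`-`t` path of `H` that avoids `x`). -/
def markedSet (G : SimpleGraph V) (s t : V) : Set V :=
  {x | ∃ a b : V, (reducedGraph G s t).Adj a b ∧
    (reducedGraph G s t).Adj a x ∧ (reducedGraph G s t).Adj b x ∧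
    ∃ p : (reducedGraph G s t).spanningCoe.Path s t, x ∉ p.1.support ∧ s(a, b) ∈ p.1.edges}

end Graphs

/-! A random access machine in structured form. A program has variables and arrays, each named by
a constant of the program text; array cells are addressed by computed values. All values are
natural numbers below a word bound `W`. -/

/-- Contents of the variables and of the arrays. -/
structure State where
  vars : ℕ → ℕ
  arrs : ℕ → ℕ → ℕ

/-- Arithmetic expressions. -/
inductive Expr : Type where
  | lit (k : ℕ)
  | var (x : ℕ)
  | get (a : ℕ) (e : Expr)
  | add (e f : Expr)
  | sub (e f : Expr)
  | mul (e f : Expr)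
  | lt (e f : Expr)

/-- The value of an expression; `sub` is truncated, and `lt` gives `1` for true, `0` for false. -/
def Expr.eval (σ : State) : Expr → ℕ
  | .lit k => k
  | .var x => σ.vars x
  | .get a e => σ.arrs a (e.eval σ)
  | .add e f => e.eval σ + f.eval σ
  | .sub e f => e.eval σ - f.eval σ
  | .mul e f => e.eval σ * f.eval σ
  | .lt e f => if e.eval σ < f.eval σ then 1 else 0

/-- No value that occurs in the evaluation of the expression overflows the word bound. -/
def Expr.Fits (W : ℕ) (σ : State) : Expr → Prop
  | .lit k => k < W
  | .var x => σ.vars x < W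
  | .get a e => e.Fits W σ ∧ σ.arrs a (e.eval σ) < W
  | .add e f => e.Fits W σ ∧ f.Fits W σ ∧ e.eval σ + f.eval σ < W
  | .sub e f => e.Fits W σ ∧ f.Fits W σ
  | .mul e f => e.Fits W σ ∧ f.Fits W σ ∧ e.eval σ * f.eval σ < W
  | .lt e f => e.Fits W σ ∧ f.Fits W σ ∧ 1 < W

/-- The number of elementary operations in the evaluation of an expression. -/
def Expr.cost : Expr → ℕ
  | .lit _ => 1
  | .var _ => 1
  | .get _ e => e.cost + 1
  | .add e f => e.cost + f.cost + 1
  | .sub e f => e.cost + f.cost + 1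
  | .mul e f => e.cost + f.cost + 1
  | .lt e f => e.cost + f.cost + 1

/-- Programs: assignment to a variable, assignment to an array cell, sequencing, branching on
whether an expression is nonzero, and looping as long as an expression is nonzero. -/
inductive Program : Type where
  | skip
  | assign (x : ℕ) (e : Expr)
  | store (a : ℕ) (i e : Expr)
  | seq (P Q : Program)
  | branch (e : Expr) (P Q : Program)
  | loop (e : Expr) (P : Program)

/-- `Exec W P σ k σ'`: started in `σ`, the program `P` halts in `σ'` after `k` steps, and no value
computed on the way reaches the word bound `W`. Every elementary operation is charged. An
overflow or an infinite loop means that there is no execution. -/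
inductive Exec (W : ℕ) : Program → State → ℕ → State → Prop where
  | skip (σ : State) : Exec W .skip σ 1 σ
  | assign (x : ℕ) (e : Expr) (σ : State) (h : e.Fits W σ) :
      Exec W (.assign x e) σ (e.cost + 1)
        ⟨Function.update σ.vars x (e.eval σ), σ.arrs⟩
  | store (a : ℕ) (i e : Expr) (σ : State) (hi : i.Fits W σ) (he : e.Fits W σ) :
      Exec W (.store a i e) σ (i.cost + e.cost + 1)
        ⟨σ.vars, Function.update σ.arrs a (Function.update (σ.arrs a) (i.eval σ) (e.eval σ))⟩
  | seq (P Q : Program) (σ σ' σ'' : State) (k l : ℕ)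
      (hP : Exec W P σ k σ') (hQ : Exec W Q σ' l σ'') :
      Exec W (.seq P Q) σ (k + l) σ''
  | branch_true (e : Expr) (P Q : Program) (σ σ' : State) (k : ℕ)
      (h : e.Fits W σ) (hv : e.eval σ ≠ 0) (hP : Exec W P σ k σ') :
      Exec W (.branch e P Q) σ (e.cost + 1 + k) σ'
  | branch_false (e : Expr) (P Q : Program) (σ σ' : State) (k : ℕ)
      (h : e.Fits W σ) (hv : e.eval σ = 0) (hQ : Exec W Q σ k σ') :
      Exec W (.branch e P Q) σ (e.cost + 1 + k) σ'
  | loop_done (e : Expr) (P : Program) (σ : State) (h : e.Fits W σ) (hv : e.eval σ = 0) :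
      Exec W (.loop e P) σ (e.cost + 1) σ
  | loop_step (e : Expr) (P : Program) (σ σ' σ'' : State) (k l : ℕ)
      (h : e.Fits W σ) (hv : e.eval σ ≠ 0) (hP : Exec W P σ k σ')
      (hL : Exec W (.loop e P) σ' l σ'') :
      Exec W (.loop e P) σ (e.cost + 1 + k + l) σ''

open Classical in
/-- The input: variables `0`, `1`, `2` hold `n`, `s`, `t`, array `0` holds the adjacency matrix of
the graph, row by row, and everything else is `0`. -/
noncomputable def inputState {n : ℕ} (G : SimpleGraph (Fin n)) (s t : Fin n) : State where
  vars x := if x = 0 then n else if x = 1 then s else if x = 2 then t else 0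
  arrs a i := if a = 0 ∧ ∃ u v : Fin n, i = u * n + v ∧ G.Adj u v then 1 else 0

/-- The output: array `1` marks the vertices of the returned set. -/
def outputSet (n : ℕ) (σ : State) : Set (Fin n) :=
  {v | σ.arrs 1 v ≠ 0}

end TrackingPaths

/-!
Part one. If `x` is marked through the edge `ab`, then a path through `ab` that avoids `x` and its
detour `a x b` differ in `x` only, so `x` belongs to every tracking set
(`markedSet_subset_of_isTrackingSet`). It remains to see that the marked set tracks.

Neither deleted vertices nor deleted edges need attention: by `mem_markedSet_of_walks`, a vertex `x`
is marked as soon as two adjacent neighbours `a`, `b` of `x` can be joined to `s` and to `t` by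
disjoint walks of `G - x`, since all edges in question then lie on `s`-`t` paths. In a chordal graph
every chord of an `s`-`t` path skips a marked vertex: inside a shortest chord there is one that
skips a single vertex (`IsPathFun.exists_mem_markedSet_of_chord`). Suppose that two paths with the
same marked vertices in the same order part at a vertex `u`. Both lead from `u` through unmarked
vertices to the same next marked vertex, or to `t`. These two segments have no chords, so
chordality, applied to the cycle through `u` and the closest contact of the segments, makes the two
successors `p`, `q` of `u` adjacent. If the path through `p` misses `q`, then `q` is marked;
otherwise it can go from `u` to `q` directly, and `p` is marked
(`IsPathFun.mem_markedSet_of_adj_next`). Either is a contradiction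
(`IsPathFun.false_of_unmarked_detours`).

Part two. In a chordal graph, `x` is marked if and only if `t` can be reached from `s` in `G - x`,
and `x` can be reached from `s` or `t` in `G - w` for every other vertex `w`
(`mem_markedSet_iff`). The second condition puts `x` on an `s`-`t` path, because the set of
vertices on such paths is closed under attaching ears (`LiesOnPath.of_adj`). The neighbours of `x`
on this path are connected in `G - x`, hence, by chordality, within the neighbourhood of `x`; the
edge along which a connecting walk leaves the part of the path before `x` for the last time marks
`x`.

So two graph searches in each `G - w` suffice. A search takes `n` rounds of linear time, each of
which inspects the neighbours of one vertex, so the total is `O(n ^ 3)`, and this is spent only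
after an edge has been found in the adjacency matrix. Execution is analysed through total
correctness statements with a time bound (`Runs`), with an invariant rule for bounded loops.
-/

namespace TrackingPaths

/-! ### Walks, marked vertices and chords -/

section Graphs

variable {V : Type*} {G : SimpleGraph V} {s t : V}

open SimpleGraph

theorem exists_walk_of_fun (f : ℕ → V) (i : ℕ) : ∀ j, i ≤ j →
    (∀ k, i ≤ k → k < j → G.Adj (f k) (f (k + 1))) →
    ∃ p : G.Walk (f i) (f j), p.support = (List.range (j + 1 - i)).map (fun k => f (i + k)) := by
  intro j hij
  induction j, hij using Nat.le_induction with
  | base =>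
    intro _
    exact ⟨Walk.nil, by simp⟩
  | succ j hij ih =>
    intro h
    obtain ⟨p, hp⟩ := ih (fun k h1 h2 => h k h1 (by omega))
    refine ⟨p.concat (h j hij (by omega)), ?_⟩
    rw [Walk.support_concat, hp, show j + 1 + 1 - i = (j + 1 - i) + 1 by omega, List.range_succ,
      List.map_append]
    simp [show i + (j + 1 - i) = j + 1 by omega]

theorem mem_map_range_add {f : ℕ → V} {i j : ℕ} (hij : i ≤ j) {v : V} :
    v ∈ (List.range (j + 1 - i)).map (fun k => f (i + k)) ↔ ∃ k, i ≤ k ∧ k ≤ j ∧ f k = v := by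
  simp only [List.mem_map, List.mem_range]
  constructor
  · rintro ⟨k, hk, rfl⟩
    exact ⟨i + k, by omega, by omega, rfl⟩
  · rintro ⟨k, h1, h2, rfl⟩
    exact ⟨k - i, by omega, by rw [Nat.add_sub_cancel' h1]⟩

theorem exists_walk_support_fun (f : ℕ → V) {i j : ℕ} (hij : i ≤ j)
    (h : ∀ k, i ≤ k → k < j → G.Adj (f k) (f (k + 1))) :
    ∃ p : G.Walk (f i) (f j), ∀ v, v ∈ p.support ↔ ∃ k, i ≤ k ∧ k ≤ j ∧ f k = v := by
  obtain ⟨p, hp⟩ := exists_walk_of_fun f i j hij h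
  exact ⟨p, fun v => by rw [hp, mem_map_range_add hij]⟩

/-- Disjoint paths joined by an edge form a path. -/
theorem isPath_append_cons {a b : V} {p : G.Walk s a} {q : G.Walk b t} (h : G.Adj a b)
    (hp : p.IsPath) (hq : q.IsPath) (hd : ∀ v ∈ p.support, v ∉ q.support) :
    (p.append (Walk.cons h q)).IsPath := by
  rw [Walk.isPath_def, Walk.support_append, Walk.support_cons, List.tail_cons,
    List.nodup_append]
  exact ⟨hp.support_nodup, hq.support_nodup, fun v hv w hw hvw => hd v hv (hvw ▸ hw)⟩

theorem support_append_cons {a b : V} (p : G.Walk s a) (q : G.Walk b t) (h : G.Adj a b) :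
    (p.append (Walk.cons h q)).support = p.support ++ q.support := by
  rw [Walk.support_append, Walk.support_cons, List.tail_cons]

/-- An edge `ab` between a walk from `s` and a disjoint walk to `t` lies on an `s`-`t` path, and
so does every vertex `x` off the walks that is adjacent to `a` and `b`. In particular all edges
involved survive in the reduced graph. -/
theorem mem_markedSet_of_walks {a b x : V} (p : G.Walk s a) (q : G.Walk b t)
    (hd : ∀ v ∈ p.support, v ∉ q.support) (hxp : x ∉ p.support) (hxq : x ∉ q.support)
    (hab : G.Adj a b) (hax : G.Adj a x) (hbx : G.Adj b x) : x ∈ markedSet G s t := by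
  classical
  wlog hpq : p.IsPath ∧ q.IsPath generalizing p q
  · exact this p.bypass q.bypass
      (fun v hv hv' => hd v (p.support_bypass_subset_support hv)
        (q.support_bypass_subset_support hv'))
      (fun h => hxp (p.support_bypass_subset_support h))
      (fun h => hxq (q.support_bypass_subset_support h)) ⟨p.bypass_isPath, q.bypass_isPath⟩
  obtain ⟨hp, hq⟩ := hpq
  have h1 := isPath_append_cons hab hp hq hd
  have h2 : (p.append (Walk.cons hax (Walk.cons hbx.symm q))).IsPath := by
    refine isPath_append_cons hax hp (hq.cons hxq) fun v hv hv' => ?_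
    rw [Walk.support_cons, List.mem_cons] at hv'
    rcases hv' with rfl | hv'
    · exact hxp hv
    · exact hd v hv hv'
  refine ⟨a, b, ⟨⟨_, h1⟩, by simp⟩, ⟨⟨_, h2⟩, by simp⟩, ⟨⟨_, h2⟩, by simp [Sym2.eq_swap]⟩, ?_⟩
  have hE : ∀ e ∈ (p.append (Walk.cons hab q)).edges,
      e ∈ (reducedGraph G s t).spanningCoe.edgeSet := by
    intro e he
    induction e with
    | h u v => exact ⟨⟨_, h1⟩, he⟩
  refine ⟨⟨(p.append (Walk.cons hab q)).transfer _ hE, h1.transfer hE⟩, ?_, ?_⟩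
  · rw [Walk.support_transfer, support_append_cons]
    simp [hxp, hxq]
  · rw [Walk.edges_transfer]
    simp

/-- A walk through an edge splits at that edge. -/
theorem exists_append_cons_of_mem_edges {a b : V} : ∀ {u v : V} (p : G.Walk u v),
    s(a, b) ∈ p.edges → ∃ (c d : V) (q : G.Walk u c) (h : G.Adj c d) (r : G.Walk d v),
      s(a, b) = s(c, d) ∧ p = q.append (Walk.cons h r)
  | _, _, .nil, h => by simp at h
  | u, v, .cons (v := w) hu p, h => by
    rw [Walk.edges_cons, List.mem_cons] at h
    rcases h with h | h
    · exact ⟨u, w, .nil, hu, p, h, rfl⟩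
    · obtain ⟨c, d, q, hcd, r, he, rfl⟩ := exists_append_cons_of_mem_edges p h
      exact ⟨c, d, .cons hu q, hcd, r, he, rfl⟩

/-- A marked vertex `x` can be bypassed along an `s`-`t` path without any other change, so that
only `x` itself can tell the two paths apart. -/
theorem markedSet_subset_of_isTrackingSet {T : Set V} (hT : IsTrackingSet G s t T) :
    markedSet G s t ⊆ T := by
  classical
  rintro x ⟨a, b, -, hax, hbx, p, hxp, hp⟩
  by_contra hxT
  obtain ⟨c, d, q, h, r, he, hpe⟩ := exists_append_cons_of_mem_edges _ hp
  have hcx : G.Adj c x ∧ G.Adj d x := by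
    have h1 := (reducedGraph G s t).adj_sub hax
    have h2 := (reducedGraph G s t).adj_sub hbx
    rcases Sym2.eq_iff.1 he with ⟨rfl, rfl⟩ | ⟨rfl, rfl⟩
    · exact ⟨h1, h2⟩
    · exact ⟨h2, h1⟩
  obtain ⟨hcx, hdx⟩ := hcx
  have hle : (reducedGraph G s t).spanningCoe ≤ G := Subgraph.spanningCoe_le _
  have hpp := p.2
  have hS : p.1.support = q.support ++ r.support := by rw [hpe, support_append_cons]
  rw [Walk.isPath_def, hS, List.nodup_append] at hpp
  rw [hS] at hxp
  simp only [List.mem_append, not_or] at hxp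
  have key : ∀ {u v : V} (w : (reducedGraph G s t).spanningCoe.Walk u v),
      ∃ w' : G.Walk u v, w'.support = w.support := fun w =>
    ⟨w.mapLe hle, by simp⟩
  obtain ⟨q', hq'⟩ := key q
  obtain ⟨r', hr'⟩ := key r
  have hd : ∀ v ∈ q'.support, v ∉ r'.support := fun v hv hv' =>
    hpp.2.2 v (hq' ▸ hv) v (hr' ▸ hv') rfl
  have hq : q'.IsPath := by rw [Walk.isPath_def, hq']; exact hpp.1
  have hr : r'.IsPath := by rw [Walk.isPath_def, hr']; exact hpp.2.1
  have hxq : x ∉ q'.support := by rw [hq']; exact hxp.1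
  have hxr : x ∉ r'.support := by rw [hr']; exact hxp.2
  have h1 := isPath_append_cons (hle h) hq hr hd
  have h2 : (q'.append (Walk.cons hcx (Walk.cons hdx.symm r'))).IsPath := by
    refine isPath_append_cons hcx hq (hr.cons hxr) fun v hv hv' => ?_
    rw [Walk.support_cons, List.mem_cons] at hv'
    rcases hv' with rfl | hv'
    · exact hxq hv
    · exact hd v hv hv'
  refine hT ⟨_, h1⟩ ⟨_, h2⟩ (fun h12 => ?_) ?_
  · have := congrArg (fun w : G.Path s t => x ∈ w.1.support) h12
    simp [support_append_cons, hxq, hxr] at this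
  · simp [trackerSequence, support_append_cons, hxT]

/-- The chord of a chordal graph, for a cycle `f 0, …, f L`. -/
theorem IsChordal.exists_chord (hG : IsChordal G) {f : ℕ → V} {L : ℕ} (hL : 3 ≤ L)
    (hf : Set.InjOn f {i | i ≤ L}) (hadj : ∀ k < L, G.Adj (f k) (f (k + 1)))
    (hclose : G.Adj (f 0) (f L)) :
    ∃ i j, i + 2 ≤ j ∧ j ≤ L ∧ ¬(i = 0 ∧ j = L) ∧ G.Adj (f i) (f j) := by
  obtain ⟨p, hp⟩ := exists_walk_of_fun f 0 L (Nat.zero_le _) (fun k _ h => hadj k h)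
  have hlen : p.length = L := by
    have := congrArg List.length hp
    simpa using this
  have hget : ∀ i ≤ L, p.getVert i = f i := by
    intro i hi
    rw [Walk.getVert_eq_support_getElem p (by omega)]
    simp [hp]
  have hpath : p.IsPath := by
    rw [← Walk.IsPath.getVert_injOn_iff]
    intro i hi j hj hij
    rw [Set.mem_ofPred_eq, hlen] at hi hj
    rw [hget i hi, hget j hj] at hij
    exact hf hi hj hij
  have hedge : ∀ i < L, s(f i, f (i + 1)) ∈ p.edges := by
    intro i hi
    rw [← hget i hi.le, ← hget (i + 1) hi, ← Walk.mem_edges_toSubgraph]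
    exact Walk.toSubgraph_adj_getVert p (by omega)
  have hnot : s(f L, f 0) ∉ p.edges := by
    intro h
    rw [← Walk.mem_edges_toSubgraph, Subgraph.mem_edgeSet] at h
    obtain ⟨i, hi, hi'⟩ := (Walk.toSubgraph_adj_iff p).1 h
    rw [hget i (by omega), hget (i + 1) (by omega)] at hi
    rcases Sym2.eq_iff.1 hi with ⟨h1, h2⟩ | ⟨h1, h2⟩
    · have := hf (show _ ≤ L by omega) (show _ ≤ L by omega) h2
      omega
    · have := hf (show _ ≤ L by omega) (show _ ≤ L by omega) h1
      have := hf (show _ ≤ L by omega) (show _ ≤ L by omega) h2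
      omega
  have hcyc : (Walk.cons hclose.symm p).IsCycle :=
    (Walk.cons_isCycle_iff p hclose.symm).2 ⟨hpath, hnot⟩
  obtain ⟨a, ha, b, hb, hab, hne⟩ := hG _ _ hcyc (by simp [hlen]; omega)
  have hsupp : ∀ v ∈ (Walk.cons hclose.symm p).support, ∃ k ≤ L, f k = v := by
    intro v hv
    rw [Walk.support_cons, List.mem_cons] at hv
    rcases hv with rfl | hv
    · exact ⟨L, le_rfl, rfl⟩
    · rw [hp] at hv
      obtain ⟨k, -, h, h'⟩ := (mem_map_range_add (Nat.zero_le _)).1 hv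
      exact ⟨k, h, h'⟩
  obtain ⟨i, hi, rfl⟩ := hsupp a ha
  obtain ⟨j, hj, rfl⟩ := hsupp b hb
  rw [Walk.edges_cons, List.mem_cons, not_or] at hne
  wlog hij : i ≤ j generalizing i j
  · exact this j hj hb i hi ha hab.symm (by rwa [Sym2.eq_swap]) (by omega)
  have h1 : i ≠ j := by rintro rfl; exact G.irrefl hab
  have h2 : j ≠ i + 1 := by rintro rfl; exact hne.2 (hedge i (by omega))
  refine ⟨i, j, by omega, hj, ?_, hab⟩
  rintro ⟨rfl, rfl⟩
  exact hne.1 Sym2.eq_swap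

end Graphs

/-! ### The marked set is a tracking set -/

section Tracking

variable {V : Type*} {G : SimpleGraph V} {s t : V}

open SimpleGraph

/-- `f 0, …, f L` are the vertices of an `s`-`t` path of `G`, in this order; the values of `f`
beyond `L` are irrelevant. -/
structure IsPathFun (G : SimpleGraph V) (s t : V) (f : ℕ → V) (L : ℕ) : Prop where
  injOn : Set.InjOn f {i | i ≤ L}
  adj : ∀ k < L, G.Adj (f k) (f (k + 1))
  start : f 0 = s
  finish : f L = t

theorem isPathFun_getVert {p : G.Walk s t} (hp : p.IsPath) :
    IsPathFun G s t p.getVert p.length where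
  injOn := hp.getVert_injOn
  adj _ hk := p.adj_getVert_succ hk
  start := p.getVert_zero
  finish := p.getVert_length

theorem IsPathFun.eq {f : ℕ → V} {L i j : ℕ} (h : IsPathFun G s t f L) (hi : i ≤ L) (hj : j ≤ L)
    (hij : f i = f j) : i = j := h.injOn hi hj hij

/-- Two disjoint segments of `s`-`t` paths, one from `s` and one to `t`, whose ends are adjacent,
mark every common neighbour of these ends that they avoid. -/
theorem IsPathFun.mem_markedSet {f g : ℕ → V} {L K i j : ℕ} {x : V} (hf : IsPathFun G s t f L)
    (hg : IsPathFun G s t g K) (hi : i ≤ L) (hj : j ≤ K)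
    (hd : ∀ a ≤ i, ∀ b, j ≤ b → b ≤ K → f a ≠ g b) (hxf : ∀ a ≤ i, f a ≠ x)
    (hxg : ∀ b, j ≤ b → b ≤ K → g b ≠ x) (h : G.Adj (f i) (g j)) (h1 : G.Adj (f i) x)
    (h2 : G.Adj (g j) x) : x ∈ markedSet G s t := by
  obtain ⟨p, hp⟩ := exists_walk_support_fun f (Nat.zero_le i)
    (fun k _ hk => hf.adj k (by omega))
  obtain ⟨q, hq⟩ := exists_walk_support_fun g hj (fun k _ hk => hg.adj k hk)
  rw [← hf.start, ← hg.finish]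
  refine mem_markedSet_of_walks p q ?_ ?_ ?_ h h1 h2
  · intro v hv hv'
    obtain ⟨a, -, ha, rfl⟩ := (hp v).1 hv
    obtain ⟨b, hb, hb', h⟩ := (hq _).1 hv'
    exact hd a ha b hb hb' h.symm
  · intro hv
    obtain ⟨a, -, ha, h⟩ := (hp _).1 hv
    exact hxf a ha h
  · intro hv
    obtain ⟨b, hb, hb', h⟩ := (hq _).1 hv
    exact hxg b hb hb' h

/-- In a chordal graph, every chord of an `s`-`t` path skips a marked vertex: a shortest chord
among those inside the skipped part skips a single vertex. -/
theorem IsPathFun.exists_mem_markedSet_of_chord (hG : IsChordal G) {f : ℕ → V} {L : ℕ}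
    (hf : IsPathFun G s t f L) {i j : ℕ} (hij : i + 2 ≤ j) (hj : j ≤ L)
    (h : G.Adj (f i) (f j)) : ∃ k, i < k ∧ k < j ∧ f k ∈ markedSet G s t := by
  induction hn : j - i using Nat.strong_induction_on generalizing i j with
  | _ n ih =>
    rcases hij.eq_or_lt with rfl | hlt
    · refine ⟨i + 1, by omega, by omega, hf.mem_markedSet hf (i := i) (j := i + 2) (by omega) hj
        ?_ ?_ ?_ h (hf.adj i (by omega)) (hf.adj (i + 1) (by omega)).symm⟩
      · intro a ha b hb hb' hab
        have := hf.eq (by omega) (by omega) hab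
        omega
      · intro a ha hab
        have := hf.eq (by omega) (by omega) hab
        omega
      · intro b hb hb' hab
        have := hf.eq (by omega) (by omega) hab
        omega
    · obtain ⟨a, b, h1, h2, h3, h4⟩ := hG.exists_chord (f := fun k => f (i + k)) (L := j - i)
        (by omega)
        (fun a ha b hb hab => by
          rw [Set.mem_ofPred_eq] at ha hb
          have := hf.eq (by omega) (by omega) hab
          omega)
        (fun k hk => hf.adj (i + k) (by omega))
        (by simpa [Nat.add_sub_cancel' (show i ≤ j by omega)] using h)
      obtain ⟨k, hk, hk', hm⟩ := ih (i + b - (i + a)) (by omega) (i := i + a) (j := i + b)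
        (by omega) (by omega) h4 rfl
      exact ⟨k, by omega, by omega, hm⟩

/-- Two `s`-`t` paths that part at `f k` towards adjacent vertices: one of the two next vertices
is marked. -/
theorem IsPathFun.mem_markedSet_of_adj_next {f g : ℕ → V} {L K k : ℕ} (hf : IsPathFun G s t f L)
    (hg : IsPathFun G s t g K) (hkL : k < L) (hkK : k < K) (heq : ∀ i ≤ k, f i = g i)
    (hadj : G.Adj (f (k + 1)) (g (k + 1))) :
    f (k + 1) ∈ markedSet G s t ∨ g (k + 1) ∈ markedSet G s t := by
  have hfk : G.Adj (f k) (f (k + 1)) := hf.adj k hkL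
  have hgk : G.Adj (f k) (g (k + 1)) := by rw [heq k le_rfl]; exact hg.adj k hkK
  have hgf : ∀ a ≤ k, f a ≠ g (k + 1) := by
    intro a ha h
    rw [heq a ha] at h
    have := hg.eq (by omega) (by omega) h
    omega
  by_cases h : ∃ j ≤ L, f j = g (k + 1)
  · obtain ⟨j, hj, hjg⟩ := h
    have hjk : k + 1 < j := by
      by_contra hcon
      rcases Nat.lt_or_ge k j with h | h
      · obtain rfl : j = k + 1 := by omega
        rw [hjg] at hadj
        exact G.irrefl hadj
      · exact hgf j h hjg
    -- the path can skip `f (k + 1)` by going from `f k` to `g (k + 1)` directly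
    left
    refine hf.mem_markedSet hf (i := k) (j := j) (by omega) hj ?_ ?_ ?_ (by rwa [hjg]) hfk
      (by rw [hjg]; exact hadj.symm)
    · intro a ha b hb hb' hab
      have := hf.eq (by omega) (by omega) hab
      omega
    · intro a ha hab
      have := hf.eq (by omega) (by omega) hab
      omega
    · intro b hb hb' hab
      have := hf.eq (by omega) (by omega) hab
      omega
  · push Not at h
    right
    refine hf.mem_markedSet hf (i := k) (j := k + 1) (by omega) (by omega) ?_ hgf ?_ hfk hgk hadj
    · intro a ha b hb hb' hab
      have := hf.eq (by omega) (by omega) hab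
      omega
    · intro b _ hb'
      exact h b hb'

/-- In a chordal graph there are no two `s`-`t` paths that part at `f k` and lead on through
unmarked vertices to a common vertex; `I` and `J` are the distances of that vertex from `f k`. -/
theorem IsPathFun.false_of_unmarked_detours (hG : IsChordal G) {f g : ℕ → V} {L K k I J : ℕ}
    (hf : IsPathFun G s t f L) (hg : IsPathFun G s t g K) (heq : ∀ i ≤ k, f i = g i)
    (hne : f (k + 1) ≠ g (k + 1)) (hI : k + I ≤ L) (hJ : k + J ≤ K) (hI1 : 1 ≤ I) (hJ1 : 1 ≤ J)
    (hw : f (k + I) = g (k + J))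
    (hfM : ∀ i, 1 ≤ i → i < I → f (k + i) ∉ markedSet G s t)
    (hgM : ∀ j, 1 ≤ j → j < J → g (k + j) ∉ markedSet G s t) : False := by
  classical
  have noF : ∀ a b, a + 2 ≤ b → b ≤ I → ¬ G.Adj (f (k + a)) (f (k + b)) := by
    intro a b hab hb h
    obtain ⟨c, h1, h2, h3⟩ := hf.exists_mem_markedSet_of_chord hG (by omega) (by omega) h
    have := hfM (c - k) (by omega) (by omega)
    rw [Nat.add_sub_cancel' (by omega)] at this
    exact this h3
  have noG : ∀ a b, a + 2 ≤ b → b ≤ J → ¬ G.Adj (g (k + a)) (g (k + b)) := by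
    intro a b hab hb h
    obtain ⟨c, h1, h2, h3⟩ := hg.exists_mem_markedSet_of_chord hG (by omega) (by omega) h
    have := hgM (c - k) (by omega) (by omega)
    rw [Nat.add_sub_cancel' (by omega)] at this
    exact this h3
  -- the closest contact of the two detours
  have hex : ∃ n i j, 1 ≤ i ∧ i ≤ I ∧ 1 ≤ j ∧ j ≤ J ∧
      (f (k + i) = g (k + j) ∨ G.Adj (f (k + i)) (g (k + j))) ∧ i + j = n :=
    ⟨_, I, J, hI1, le_rfl, hJ1, le_rfl, .inl hw, rfl⟩
  obtain ⟨i, j, hi, hiI, hj, hjJ, hc, hn⟩ := Nat.find_spec hex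
  have hmin : ∀ a b, 1 ≤ a → a ≤ I → 1 ≤ b → b ≤ J → a + b < i + j →
      f (k + a) ≠ g (k + b) ∧ ¬ G.Adj (f (k + a)) (g (k + b)) := by
    intro a b h1 h2 h3 h4 hlt
    rw [hn] at hlt
    have := Nat.find_min hex hlt
    constructor <;> intro h <;> exact this ⟨a, b, h1, h2, h3, h4, by tauto, rfl⟩
  have hcadj : G.Adj (f (k + i)) (g (k + j)) := by
    refine hc.resolve_left fun h => ?_
    rcases Nat.lt_or_ge 1 i with h1 | h1
    · refine (hmin (i - 1) j (by omega) (by omega) hj hjJ (by omega)).2 ?_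
      have := hf.adj (k + (i - 1)) (by omega)
      rwa [show k + (i - 1) + 1 = k + i by omega, h] at this
    · rcases Nat.lt_or_ge 1 j with h2 | h2
      · refine (hmin i (j - 1) hi hiI (by omega) (by omega) (by omega)).2 ?_
        have := hg.adj (k + (j - 1)) (by omega)
        rw [show k + (j - 1) + 1 = k + j by omega, ← h] at this
        exact this.symm
      · obtain rfl : i = 1 := by omega
        obtain rfl : j = 1 := by omega
        exact hne h
  have hfg : ∀ a b, a ≤ i → 1 ≤ b → b ≤ j → f (k + a) ≠ g (k + b) := by
    intro a b ha hb hb' h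
    rcases Nat.eq_zero_or_pos a with rfl | ha0
    · rw [heq (k + 0) (by omega)] at h
      have := hg.eq (by omega) (by omega) h
      omega
    · rcases Nat.lt_or_ge (a + b) (i + j) with hlt | hge
      · exact (hmin a b ha0 (by omega) hb (by omega) hlt).1 h
      · obtain rfl : a = i := by omega
        obtain rfl : b = j := by omega
        rw [h] at hcadj
        exact G.irrefl hcadj
  -- the cycle `f (k + i), …, f k = g k, …, g (k + j)` has no chord, so it is a triangle
  have hone : i = 1 ∧ j = 1 := by
    by_contra hcon
    have hF : ∀ n ≤ i, (fun n => if n ≤ i then f (k + (i - n)) else g (k + (n - i))) n =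
        f (k + (i - n)) := fun n hn => if_pos hn
    have hG' : ∀ n, i ≤ n → (fun n => if n ≤ i then f (k + (i - n)) else g (k + (n - i))) n =
        g (k + (n - i)) := by
      intro n hn
      rcases hn.eq_or_lt with rfl | hlt
      · simp [heq k le_rfl]
      · exact if_neg (by omega)
    revert hF hG'
    generalize (fun n => if n ≤ i then f (k + (i - n)) else g (k + (n - i))) = c
    intro hF hG'
    have hinj : Set.InjOn c {n | n ≤ i + j} := by
      intro a ha b hb hab
      rw [Set.mem_ofPred_eq] at ha hb
      wlog hle : a ≤ b generalizing a b
      · exact (this hb ha hab.symm (by omega)).symm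
      rcases Nat.lt_or_ge i b with hb' | hb'
      · rw [hG' b hb'.le] at hab
        rcases Nat.lt_or_ge i a with ha' | ha'
        · rw [hG' a ha'.le] at hab
          have := hg.eq (by omega) (by omega) hab
          omega
        · rw [hF a ha'] at hab
          exact absurd hab (hfg _ _ (by omega) (by omega) (by omega))
      · rw [hF b hb', hF a (by omega)] at hab
        have := hf.eq (by omega) (by omega) hab
        omega
    have hadj : ∀ n < i + j, G.Adj (c n) (c (n + 1)) := by
      intro n hn
      rcases Nat.lt_or_ge n i with h | h
      · rw [hF n h.le, hF (n + 1) h]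
        have := hf.adj (k + (i - (n + 1))) (by omega)
        rw [show k + (i - (n + 1)) + 1 = k + (i - n) by omega] at this
        exact this.symm
      · rw [hG' n h, hG' (n + 1) (by omega)]
        have := hg.adj (k + (n - i)) (by omega)
        rwa [show k + (n - i) + 1 = k + (n + 1 - i) by omega] at this
    have hclose : G.Adj (c 0) (c (i + j)) := by
      rw [hF 0 (by omega), hG' (i + j) (by omega)]
      simpa using hcadj
    obtain ⟨a, b, h1, h2, h3, h4⟩ := hG.exists_chord (f := c) (L := i + j) (by omega) hinj
      hadj hclose
    rcases Nat.lt_or_ge i b with hb | hb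
    · rw [hG' b hb.le] at h4
      rcases Nat.lt_or_ge a i with ha | ha
      · rw [hF a ha.le] at h4
        exact (hmin (i - a) (b - i) (by omega) (by omega) (by omega) (by omega) (by omega)).2 h4
      · rw [hG' a ha] at h4
        exact noG _ _ (by omega) (by omega) h4
    · rw [hF b hb, hF a (by omega)] at h4
      exact noF _ _ (by omega) (by omega) h4.symm
  obtain ⟨rfl, rfl⟩ := hone
  -- neither detour is a single edge: it would be a chord of the other one
  have hI2 : 1 < I := by
    by_contra h
    obtain rfl : I = 1 := by omega
    have hJ2 : J ≠ 1 := by rintro rfl; exact hne hw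
    refine noG 0 J (by omega) le_rfl ?_
    rw [← hw, add_zero, ← heq k le_rfl]
    exact hf.adj k (by omega)
  have hJ2 : 1 < J := by
    by_contra h
    obtain rfl : J = 1 := by omega
    refine noF 0 I (by omega) le_rfl ?_
    rw [hw, add_zero, heq k le_rfl]
    exact hg.adj k (by omega)
  rcases hf.mem_markedSet_of_adj_next hg (by omega) (by omega) heq hcadj with h | h
  · exact hfM 1 le_rfl hI2 h
  · exact hgM 1 le_rfl hJ2 h

/-- Lists with the same last element and the same elements selected by `P` share an element that
is preceded by unselected elements in both lists. -/
theorem exists_common_of_filter_eq {α : Type*} (P : α → Bool) {l m : List α} (z : α)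
    (hl : l.getLast? = some z) (hm : m.getLast? = some z) (h : l.filter P = m.filter P) :
    ∃ (w : α) (l₁ l₂ m₁ m₂ : List α), l = l₁ ++ w :: l₂ ∧ m = m₁ ++ w :: m₂ ∧
      (∀ x ∈ l₁, ¬ P x) ∧ (∀ x ∈ m₁, ¬ P x) := by
  cases hfl : l.filter P with
  | nil =>
    rw [List.getLast?_eq_some_iff] at hl hm
    obtain ⟨l', rfl⟩ := hl
    obtain ⟨m', rfl⟩ := hm
    rw [hfl, eq_comm] at h
    rw [List.filter_eq_nil_iff] at h hfl
    exact ⟨z, l', [], m', [], rfl, rfl, fun x hx => hfl x (by simp [hx]),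
      fun x hx => h x (by simp [hx])⟩
  | cons w ws =>
    rw [hfl, eq_comm, List.filter_eq_cons_iff] at h
    rw [List.filter_eq_cons_iff] at hfl
    obtain ⟨l₁, l₂, rfl, h1, -, -⟩ := hfl
    obtain ⟨m₁, m₂, rfl, h2, -, -⟩ := h
    exact ⟨w, l₁, l₂, m₁, m₂, rfl, rfl, h1, h2⟩

theorem getVert_of_drop_support {p : G.Walk s t} {k : ℕ} {l₁ l₂ : List V} {w : V}
    (h : p.support.drop k = l₁ ++ w :: l₂) :
    k + l₁.length ≤ p.length ∧ p.getVert (k + l₁.length) = w ∧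
      ∀ i < l₁.length, p.getVert (k + i) ∈ l₁ := by
  have hlen := congrArg List.length h
  simp only [List.length_drop, Walk.length_support, List.length_append, List.length_cons] at hlen
  have hget : ∀ i ≤ l₁.length, p.support[k + i]? = (l₁ ++ w :: l₂)[i]? := by
    intro i _
    rw [← h, List.getElem?_drop]
  have hv : ∀ i ≤ l₁.length, some (p.getVert (k + i)) = (l₁ ++ w :: l₂)[i]? := by
    intro i hi
    rw [← hget i hi, Walk.getVert_eq_support_getElem? p (by omega)]
  refine ⟨by omega, ?_, ?_⟩
  · have := hv _ le_rfl
    simpa using this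
  · intro i hi
    have := hv i hi.le
    rw [List.getElem?_append_left hi, List.getElem?_eq_getElem hi, Option.some_inj] at this
    rw [this]
    exact List.getElem_mem hi

/-- In a chordal graph the marked set tells any two `s`-`t` paths apart. -/
theorem isTrackingSet_markedSet (hG : IsChordal G) : IsTrackingSet G s t (markedSet G s t) := by
  classical
  rintro ⟨p, hp⟩ ⟨q, hq⟩ hpq htr
  have hf := isPathFun_getVert hp
  have hg := isPathFun_getVert hq
  have hex : ∃ n, p.getVert n ≠ q.getVert n := by
    by_contra! h
    exact hpq (Subtype.ext (Walk.ext_getVert h))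
  obtain ⟨k, hk⟩ : ∃ k, Nat.find hex = k + 1 := by
    refine Nat.exists_eq_succ_of_ne_zero fun h => ?_
    have := Nat.find_spec hex
    rw [h] at this
    simp at this
  have hne := Nat.find_spec hex
  rw [hk] at hne
  have heq : ∀ i ≤ k, p.getVert i = q.getVert i := by
    intro i hi
    have := Nat.find_min hex (show i < Nat.find hex by omega)
    simpa using this
  have hkp : k < p.length := by
    by_contra! h
    have h1 := heq p.length h
    rw [p.getVert_length] at h1
    have : q.length ≤ p.length := by
      by_contra! hlt
      have := hg.eq hlt.le le_rfl (by rw [← h1, q.getVert_length])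
      omega
    exact hne (by rw [p.getVert_of_length_le (by omega), q.getVert_of_length_le (by omega)])
  have hkq : k < q.length := by
    by_contra! h
    have h1 := heq q.length h
    rw [q.getVert_length] at h1
    have : p.length ≤ q.length := by
      by_contra! hlt
      have := hf.eq hlt.le le_rfl (by rw [h1, p.getVert_length])
      omega
    exact hne (by rw [p.getVert_of_length_le (by omega), q.getVert_of_length_le (by omega)])
  have htake : p.support.take (k + 1) = q.support.take (k + 1) := by
    refine List.ext_getElem (by simp; omega) fun i h1 h2 => ?_
    rw [List.length_take] at h1 h2
    rw [List.getElem_take, List.getElem_take, Walk.support_getElem_eq_getVert,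
      Walk.support_getElem_eq_getVert]
    exact heq i (by omega)
  have hdrop : (p.support.drop (k + 1)).filter (fun v => decide (v ∈ markedSet G s t)) =
      (q.support.drop (k + 1)).filter (fun v => decide (v ∈ markedSet G s t)) := by
    unfold trackerSequence at htr
    rw [← List.take_append_drop (k + 1) p.support, ← List.take_append_drop (k + 1) q.support,
      List.filter_append, List.filter_append, htake] at htr
    exact List.append_cancel_left htr
  have hlast : ∀ r : G.Walk s t, k < r.length →
      (r.support.drop (k + 1)).getLast? = some t := by
    intro r hr
    rw [List.getLast?_drop, if_neg (by simp; omega), List.getLast?_eq_getLast_of_ne_nil (by simp),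
      r.getLast_support]
  obtain ⟨w, l₁, l₂, m₁, m₂, hl, hm, hl₁, hm₁⟩ :=
    exists_common_of_filter_eq _ t (hlast p hkp) (hlast q hkq) hdrop
  obtain ⟨a1, a2, a3⟩ := getVert_of_drop_support hl
  obtain ⟨b1, b2, b3⟩ := getVert_of_drop_support hm
  refine hf.false_of_unmarked_detours hG hg heq hne (I := 1 + l₁.length) (J := 1 + m₁.length)
    (by omega) (by omega) (by omega) (by omega) ?_ ?_ ?_
  · rw [← add_assoc, ← add_assoc, a2, b2]
  · intro i h1 h2
    have := hl₁ _ (a3 (i - 1) (by omega))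
    rw [show k + 1 + (i - 1) = k + i by omega] at this
    simpa using this
  · intro i h1 h2
    have := hm₁ _ (b3 (i - 1) (by omega))
    rw [show k + 1 + (i - 1) = k + i by omega] at this
    simpa using this

theorem isMinimumTrackingSet_markedSet [Finite V] (hG : IsChordal G) :
    IsMinimumTrackingSet G s t (markedSet G s t) :=
  ⟨isTrackingSet_markedSet hG, fun T' hT' =>
    Set.ncard_le_ncard (markedSet_subset_of_isTrackingSet hT') (Set.toFinite T')⟩

end Tracking

/-! ### Marked vertices and reachability -/

section Characterization

variable {V : Type*} {G : SimpleGraph V} {s t : V}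

open SimpleGraph

/-- `v` can be reached from `u` in `G - w`; in particular `u ≠ w` and `v ≠ w`. -/
def ReachAvoiding (G : SimpleGraph V) (w u v : V) : Prop :=
  ∃ p : G.Walk u v, w ∉ p.support

theorem ReachAvoiding.symm {w u v : V} (h : ReachAvoiding G w u v) : ReachAvoiding G w v u := by
  obtain ⟨p, hp⟩ := h
  exact ⟨p.reverse, by simpa using hp⟩

theorem ReachAvoiding.trans {w u v x : V} (h : ReachAvoiding G w u v)
    (h' : ReachAvoiding G w v x) : ReachAvoiding G w u x := by
  obtain ⟨p, hp⟩ := h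
  obtain ⟨q, hq⟩ := h'
  exact ⟨p.append q, by simp [Walk.mem_support_append_iff, hp, hq]⟩

theorem ReachAvoiding.ne_left {w u v : V} (h : ReachAvoiding G w u v) : w ≠ u := by
  obtain ⟨p, hp⟩ := h
  rintro rfl
  exact hp p.start_mem_support

theorem ReachAvoiding.ne_right {w u v : V} (h : ReachAvoiding G w u v) : w ≠ v :=
  h.symm.ne_left

/-- `x` lies on an `s`-`t` path, expressed by two walks that meet in `x` only. -/
def LiesOnPath (G : SimpleGraph V) (s t x : V) : Prop :=
  ∃ (p : G.Walk s x) (q : G.Walk x t), ∀ v ∈ p.support, v ∈ q.support → v = x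

theorem LiesOnPath.symm {x : V} (h : LiesOnPath G s t x) : LiesOnPath G t s x := by
  obtain ⟨p, q, h⟩ := h
  exact ⟨q.reverse, p.reverse, fun v hv hv' => h v (by simpa using hv') (by simpa using hv)⟩

theorem LiesOnPath.exists_isPath {x : V} (h : LiesOnPath G s t x) :
    ∃ (p : G.Walk s x) (q : G.Walk x t), p.IsPath ∧ q.IsPath ∧
      ∀ v ∈ p.support, v ∈ q.support → v = x := by
  classical
  obtain ⟨p, q, h⟩ := h
  exact ⟨p.bypass, q.bypass, p.bypass_isPath, q.bypass_isPath, fun v hv hv' =>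
    h v (p.support_bypass_subset_support hv) (q.support_bypass_subset_support hv')⟩

theorem eq_of_mem_takeUntil_of_mem_dropUntil [DecidableEq V] {u v x y : V} {p : G.Walk u v}
    (hp : p.IsPath) (hx : x ∈ p.support) (h1 : y ∈ (p.takeUntil x hx).support)
    (h2 : y ∈ (p.dropUntil x hx).support) : y = x := by
  by_contra hne
  rw [← p.take_spec hx, Walk.isPath_def, Walk.support_append, List.nodup_append] at hp
  refine hp.2.2 y h1 y ?_ rfl
  rw [← Walk.cons_tail_support, List.mem_cons] at h2
  exact h2.resolve_left hne

theorem exists_walk_of_isPath {x e : V} {p : G.Walk x e} (hp : p.IsPath) (hne : x ≠ e) :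
    ∃ (a : V) (q : G.Walk a e), G.Adj x a ∧ x ∉ q.support ∧ ∀ v ∈ q.support, v ∈ p.support := by
  cases p with
  | nil => exact absurd rfl hne
  | cons h q =>
    rw [Walk.cons_isPath_iff] at hp
    exact ⟨_, q, h, hp.2, fun v hv => by simp [hv]⟩

/-- The part of a walk before it enters the set `Z` for the first time. -/
theorem exists_walk_before_hit (Z : Set V) : ∀ {u v : V} (p : G.Walk u v), u ∉ Z → v ∈ Z →
    ∃ (r h : V) (q : G.Walk u r), G.Adj r h ∧ h ∈ Z ∧ h ∈ p.support ∧
      ∀ x ∈ q.support, x ∈ p.support ∧ x ∉ Z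
  | _, _, .nil, hu, hv => absurd hv hu
  | u, _, .cons (v := w) huw p, hu, hv => by
    by_cases hw : w ∈ Z
    · exact ⟨u, w, .nil, huw, hw, by simp, by simp [hu]⟩
    · obtain ⟨r, h, q, h1, h2, h3, h4⟩ := exists_walk_before_hit Z p hw hv
      refine ⟨r, h, .cons huw q, h1, h2, by simp [h3], ?_⟩
      intro x hx
      rw [Walk.support_cons, List.mem_cons] at hx ⊢
      rcases hx with rfl | hx
      · exact ⟨.inl rfl, hu⟩
      · exact ⟨.inr (h4 x hx).1, (h4 x hx).2⟩

theorem exists_walk_to_hit (Z : Set V) {u v : V} (p : G.Walk u v) (hv : v ∈ Z) :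
    ∃ (h : V) (q : G.Walk u h), h ∈ Z ∧ ∀ x ∈ q.support, x ∈ p.support ∧ (x ∈ Z → x = h) := by
  by_cases hu : u ∈ Z
  · exact ⟨u, .nil, hu, by simp⟩
  · obtain ⟨r, h, q, h1, h2, h3, h4⟩ := exists_walk_before_hit Z p hu hv
    refine ⟨h, q.concat h1, h2, fun x hx => ?_⟩
    rw [Walk.support_concat, List.mem_append, List.mem_singleton] at hx
    rcases hx with hx | rfl
    · exact ⟨(h4 x hx).1, fun hxZ => absurd hxZ (h4 x hx).2⟩
    · exact ⟨h3, fun _ => rfl⟩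

/-- The vertices on `s`-`t` paths are closed under attaching ears: leave the path through `y` at
`y` towards `r`, and return to it at another vertex. -/
theorem LiesOnPath.of_adj {y r : V} (hy : LiesOnPath G s t y) (hyr : G.Adj y r)
    (hr : ReachAvoiding G y r s ∨ ReachAvoiding G y r t) : LiesOnPath G s t r := by
  classical
  obtain ⟨p, q, hp, hq, hd⟩ := hy.exists_isPath
  have hr' : ∃ e, (e ∈ p.support ∨ e ∈ q.support) ∧ ReachAvoiding G y r e := by
    rcases hr with h | h
    · exact ⟨s, .inl p.start_mem_support, h⟩
    · exact ⟨t, .inr q.end_mem_support, h⟩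
  obtain ⟨e, he, R₀, hR₀⟩ := hr'
  obtain ⟨h, R, hh, hR⟩ := exists_walk_to_hit {v | v ∈ p.support ∨ v ∈ q.support} R₀ he
  have hhy : h ≠ y := by
    rintro rfl
    exact hR₀ (hR _ R.end_mem_support).1
  clear he hr hy
  wlog hhq : h ∈ q.support generalizing s t p q
  · refine (this q.reverse p.reverse hq.reverse hp.reverse ?_ ?_ ?_ ?_).symm
    · intro v hv hv'
      exact hd v (by simpa using hv') (by simpa using hv)
    · simpa [or_comm] using hh
    · simpa [or_comm] using hR
    · simpa using hh.resolve_right hhq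
  refine ⟨p.concat hyr, R.append (q.dropUntil h hhq), fun v hv hv' => ?_⟩
  rw [Walk.support_concat, List.mem_append, List.mem_singleton] at hv
  rcases hv with hv | hv
  · exfalso
    rcases (Walk.mem_support_append_iff _ _).1 hv' with hv' | hv'
    · obtain rfl := (hR v hv').2 (.inl hv)
      exact hhy (hd _ hv hhq)
    · obtain rfl := hd v hv (q.support_dropUntil_subset_support hhq hv')
      exact hhy (eq_of_mem_takeUntil_of_mem_dropUntil hq hhq (Walk.start_mem_support _) hv').symm
  · exact hv

/-- A vertex that no single vertex separates from `{s, t}` lies on an `s`-`t` path. -/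
theorem liesOnPath_of_forall_reachAvoiding {x : V} (hst : ReachAvoiding G x s t)
    (hx : ∀ w, w ≠ x → ReachAvoiding G w s x ∨ ReachAvoiding G w t x) : LiesOnPath G s t x := by
  by_contra hxS
  have hs : LiesOnPath G s t s := by
    obtain ⟨p, -⟩ := hst
    exact ⟨.nil, p, by simp⟩
  obtain ⟨p, -⟩ : ReachAvoiding G t s x :=
    (hx t hst.ne_right.symm).resolve_right fun h => h.ne_left rfl
  obtain ⟨r, y, q, hry, hy, -, hq⟩ := exists_walk_before_hit {v | LiesOnPath G s t v} p.reverse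
    hxS hs
  have hxr : ReachAvoiding G y x r := ⟨q, fun h => (hq y h).2 hy⟩
  refine (hq r q.end_mem_support).2 (LiesOnPath.of_adj hy hry.symm ?_)
  exact (hx y (by rintro rfl; exact hxS hy)).imp (fun h => hxr.symm.trans h.symm)
    (fun h => hxr.symm.trans h.symm)

/-- Neighbours of `x` in a chordal graph that are connected in `G - x` are connected within the
neighbourhood of `x`. -/
theorem IsChordal.exists_walk_in_neighborhood (hG : IsChordal G) {x : V} :
    ∀ (n : ℕ) {a b : V} (p : G.Walk a b), p.length = n → x ∉ p.support → G.Adj a x → G.Adj b x →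
      ∃ q : G.Walk a b, ∀ v ∈ q.support, G.Adj v x := by
  classical
  intro n
  induction n using Nat.strong_induction_on with
  | _ n ih =>
  intro a b p hn hxp ha hb
  have hb' := p.length_bypass_le_length
  by_cases hlt : p.bypass.length < n
  · exact ih _ hlt p.bypass rfl (fun h => hxp (p.support_bypass_subset_support h)) ha hb
  have hp : p.IsPath := by
    rw [← p.bypass_eq_self_of_length_le_length_bypass (by omega)]
    exact p.bypass_isPath
  have hf := isPathFun_getVert hp
  rcases Nat.lt_or_ge n 2 with h2 | h2
  · refine ⟨p, fun v hv => ?_⟩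
    obtain ⟨i, rfl, hi⟩ := Walk.mem_support_iff_exists_getVert.1 hv
    rcases Nat.eq_zero_or_pos i with rfl | hi0
    · rwa [p.getVert_zero]
    · rwa [show i = p.length by omega, p.getVert_length]
  have hx : ∀ i, p.getVert i ≠ x := fun i h => hxp (h ▸ p.getVert_mem_support i)
  obtain ⟨i, j, h1, h3, h4, h5⟩ := hG.exists_chord (L := n + 1)
    (f := fun k => if k = 0 then x else p.getVert (k - 1)) (by omega)
    (fun i hi j hj hij => by
      rw [Set.mem_ofPred_eq] at hi hj
      dsimp only at hij
      split_ifs at hij with h h' h'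
      · omega
      · exact absurd hij.symm (hx _)
      · exact absurd hij (hx _)
      · have := hf.eq (by omega) (by omega) hij
        omega)
    (fun k hk => by
      rcases Nat.eq_zero_or_pos k with rfl | hk0
      · simpa using ha.symm
      · have := hf.adj (k - 1) (by omega)
        simpa [hk0.ne', Nat.sub_add_cancel hk0] using this)
    (by simpa [← hn] using hb.symm)
  rw [if_neg (show j ≠ 0 by omega)] at h5
  split_ifs at h5 with hi
  · -- a chord at `x` cuts the walk in two
    obtain ⟨q, hq⟩ := ih (j - 1) (by omega) (p.take (j - 1)) (by rw [Walk.take_length]; omega)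
      (fun h => hxp ((p.isSubwalk_take _).support_subset h)) ha h5.symm
    obtain ⟨q', hq'⟩ := ih (n - (j - 1)) (by omega) (p.drop (j - 1))
      (by rw [Walk.drop_length]; omega)
      (fun h => hxp ((p.isSubwalk_drop _).support_subset h)) h5.symm hb
    refine ⟨q.append q', fun v hv => ?_⟩
    rcases (Walk.mem_support_append_iff _ _).1 hv with hv | hv
    · exact hq v hv
    · exact hq' v hv
  · -- any other chord shortens the walk
    refine ih _ ?_ ((p.take (i - 1)).append (Walk.cons h5 (p.drop (j - 1)))) rfl ?_ ha hb
    · rw [Walk.length_append, Walk.length_cons, Walk.take_length, Walk.drop_length]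
      omega
    · rw [support_append_cons, List.mem_append, not_or]
      exact ⟨fun h => hxp ((p.isSubwalk_take _).support_subset h),
        fun h => hxp ((p.isSubwalk_drop _).support_subset h)⟩

/-- In a chordal graph, the marked vertices are the vertices on `s`-`t` paths that do not
separate `s` from `t`; both properties are expressed by reachability in vertex-deleted
subgraphs. -/
theorem mem_markedSet_iff (hG : IsChordal G) {x : V} :
    x ∈ markedSet G s t ↔ ReachAvoiding G x s t ∧
      ∀ w, w ≠ x → ReachAvoiding G w s x ∨ ReachAvoiding G w t x := by
  classical
  constructor
  · rintro ⟨a, b, -, ⟨⟨P, hP⟩, hax⟩, -, Q, hxQ, -⟩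
    refine ⟨⟨Q.1.mapLe (Subgraph.spanningCoe_le _), by simpa using hxQ⟩, fun w hw => ?_⟩
    have hx : x ∈ P.support := P.snd_mem_support_of_mem_edges hax
    by_cases h : w ∈ (P.takeUntil x hx).support
    · right
      refine ⟨(P.dropUntil x hx).reverse, fun h' => ?_⟩
      rw [Walk.support_reverse, List.mem_reverse] at h'
      exact hw (eq_of_mem_takeUntil_of_mem_dropUntil hP hx h h')
    · exact .inl ⟨_, h⟩
  · rintro ⟨hst, hx⟩
    obtain ⟨p, q, hp, hq, hd⟩ := (liesOnPath_of_forall_reachAvoiding hst hx).exists_isPath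
    obtain ⟨a, p₁, hap, hxp, hps'⟩ := exists_walk_of_isPath hp.reverse hst.ne_left
    obtain ⟨b, q₁, hbq, hxq, hqs⟩ := exists_walk_of_isPath hq hst.ne_right
    have hps : ∀ v ∈ p₁.support, v ∈ p.support := fun v hv => by simpa using hps' v hv
    have hd' : ∀ v ∈ p₁.support, v ∉ q₁.support := fun v hv hv' =>
      hxp (hd v (hps v hv) (hqs v hv') ▸ hv)
    obtain ⟨R, hR⟩ : ReachAvoiding G x a b :=
      (ReachAvoiding.trans ⟨p₁, hxp⟩ hst).trans (ReachAvoiding.symm ⟨q₁, hxq⟩)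
    obtain ⟨g, hg⟩ := hG.exists_walk_in_neighborhood _ R rfl hR hap.symm hbq.symm
    -- the last vertex `h` of `g` on the path from `s`, and the next vertex `r`
    obtain ⟨r, h, R', hrh, hh, hhg, hR'⟩ := exists_walk_before_hit {v | v ∈ p₁.support} g.reverse
      (fun h => hd' _ h q₁.start_mem_support) p₁.start_mem_support
    have hgr : ∀ v ∈ g.reverse.support, G.Adj v x := fun v hv => hg v (by simpa using hv)
    have hxR : x ∉ R'.support := fun h => G.irrefl (hgr x (hR' x h).1)
    refine mem_markedSet_of_walks (p₁.dropUntil h hh).reverse (R'.reverse.append q₁) ?_ ?_ ?_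
      hrh.symm (hgr h hhg) (hgr r (hR' r R'.end_mem_support).1)
    · intro v hv hv'
      rw [Walk.support_reverse, List.mem_reverse] at hv
      have hv := p₁.support_dropUntil_subset_support hh hv
      rcases (Walk.mem_support_append_iff _ _).1 hv' with hv' | hv'
      · exact (hR' v (by simpa using hv')).2 hv
      · exact hd' v hv hv'
    · intro hv
      rw [Walk.support_reverse, List.mem_reverse] at hv
      exact hxp (p₁.support_dropUntil_subset_support hh hv)
    · intro hv
      rcases (Walk.mem_support_append_iff _ _).1 hv with hv | hv
      · exact hxR (by simpa using hv)
      · exact hxq hv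

end Characterization

/-! ### Rules for timed execution -/

/-- Replace the value of a variable. -/
def State.setVar (σ : State) (x v : ℕ) : State := ⟨Function.update σ.vars x v, σ.arrs⟩

/-- Replace the contents of an array. -/
def State.setArr (σ : State) (a : ℕ) (f : ℕ → ℕ) : State :=
  ⟨σ.vars, Function.update σ.arrs a f⟩

/-- The set of the vertices that array `a` marks. -/
def State.arrSet (n : ℕ) (σ : State) (a : ℕ) : Set (Fin n) := {v | σ.arrs a v ≠ 0}

@[simp] theorem State.vars_setArr (σ : State) (a : ℕ) (f : ℕ → ℕ) :
    (σ.setArr a f).vars = σ.vars := rfl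

@[simp] theorem State.arrs_setVar (σ : State) (x v : ℕ) : (σ.setVar x v).arrs = σ.arrs := rfl

theorem State.vars_setVar (σ : State) (x v y : ℕ) :
    (σ.setVar x v).vars y = if y = x then v else σ.vars y := by
  simp [State.setVar, Function.update_apply]

theorem State.arrs_setArr (σ : State) (a : ℕ) (f : ℕ → ℕ) (b : ℕ) :
    (σ.setArr a f).arrs b = if b = a then f else σ.arrs b := by
  simp [State.setArr, Function.update_apply]

theorem State.setVar_setVar (σ : State) (x v w : ℕ) :
    (σ.setVar x v).setVar x w = σ.setVar x w := by
  simp [State.setVar]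

theorem State.setVar_comm (σ : State) {x y : ℕ} (h : x ≠ y) (v w : ℕ) :
    (σ.setVar x v).setVar y w = (σ.setVar y w).setVar x v := by
  simp [State.setVar, Function.update_comm h]

theorem State.setArr_setArr (σ : State) (a : ℕ) (f g : ℕ → ℕ) :
    (σ.setArr a f).setArr a g = σ.setArr a g := by
  simp [State.setArr]

theorem State.setArr_setVar (σ : State) (a : ℕ) (f : ℕ → ℕ) (x v : ℕ) :
    (σ.setVar x v).setArr a f = (σ.setArr a f).setVar x v := rfl

theorem State.setArr_self (σ : State) (a : ℕ) : σ.setArr a (σ.arrs a) = σ := by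
  simp [State.setArr]

/-- Started in `σ`, the program halts within `K` steps in a state that satisfies `Q`. -/
def Runs (W : ℕ) (P : Program) (σ : State) (K : ℕ) (Q : State → Prop) : Prop :=
  ∃ k σ', Exec W P σ k σ' ∧ k ≤ K ∧ Q σ'

section Rules

variable {W : ℕ} {σ : State} {K L : ℕ} {Q S : State → Prop}

theorem Runs.mono {P : Program} (h : Runs W P σ K Q) (hK : K ≤ L) (hQ : ∀ τ, Q τ → S τ) :
    Runs W P σ L S := by
  obtain ⟨k, τ, h1, h2, h3⟩ := h
  exact ⟨k, τ, h1, h2.trans hK, hQ τ h3⟩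

theorem runs_skip (h : Q σ) : Runs W .skip σ 1 Q :=
  ⟨1, σ, .skip σ, le_rfl, h⟩

theorem runs_assign {x : ℕ} {e : Expr} (he : e.Fits W σ) (h : Q (σ.setVar x (e.eval σ))) :
    Runs W (.assign x e) σ (e.cost + 1) Q :=
  ⟨_, _, .assign x e σ he, le_rfl, h⟩

theorem runs_store {a : ℕ} {i e : Expr} (hi : i.Fits W σ) (he : e.Fits W σ)
    (h : Q (σ.setArr a (Function.update (σ.arrs a) (i.eval σ) (e.eval σ)))) :
    Runs W (.store a i e) σ (i.cost + e.cost + 1) Q :=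
  ⟨_, _, .store a i e σ hi he, le_rfl, h⟩

theorem Runs.seq {P P' : Program} (h : Runs W P σ K Q) (h' : ∀ τ, Q τ → Runs W P' τ L S) :
    Runs W (.seq P P') σ (K + L) S := by
  obtain ⟨k, τ, h1, h2, h3⟩ := h
  obtain ⟨l, ρ, h4, h5, h6⟩ := h' τ h3
  exact ⟨k + l, ρ, .seq P P' σ τ ρ k l h1 h4, by omega, h6⟩

theorem runs_branch {P P' : Program} {e : Expr} (he : e.Fits W σ)
    (h1 : e.eval σ ≠ 0 → Runs W P σ K Q) (h2 : e.eval σ = 0 → Runs W P' σ K Q) :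
    Runs W (.branch e P P') σ (e.cost + 1 + K) Q := by
  by_cases h : e.eval σ = 0
  · obtain ⟨k, τ, h3, h4, h5⟩ := h2 h
    exact ⟨_, τ, .branch_false e P P' σ τ k he h h3, by omega, h5⟩
  · obtain ⟨k, τ, h3, h4, h5⟩ := h1 h
    exact ⟨_, τ, .branch_true e P P' σ τ k he h h3, by omega, h5⟩

/-- `for i := 0, …, b - 1 do P`, where `i` and `b` are variables. -/
def Program.forLoop (i b : ℕ) (P : Program) : Program :=
  .seq (.assign i (.lit 0))
    (.loop (.lt (.var i) (.var b)) (.seq P (.assign i (.add (.var i) (.lit 1)))))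

/-- The invariant rule for bounded loops. Each round costs `8` on top of the body: `4` for the test
and `4` for the increment; `6` is the cost of the initialization and of the last test. -/
theorem runs_forLoop {i b N : ℕ} {P : Program} (Inv : ℕ → State → Prop) (hN : N < W) (hW : 1 < W)
    (hvars : ∀ j τ, Inv j τ → τ.vars i = j ∧ τ.vars b = N) (h0 : Inv 0 (σ.setVar i 0))
    (hstep : ∀ j < N, ∀ τ, Inv j τ →
      Runs W P τ K (fun ρ => ρ.vars i = j ∧ Inv (j + 1) (ρ.setVar i (j + 1)))) :
    Runs W (.forLoop i b P) σ (N * (K + 8) + 6) (Inv N) := by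
  have hloop : ∀ d j, j + d = N → ∀ τ, Inv j τ →
      Runs W (.loop (.lt (.var i) (.var b)) (.seq P (.assign i (.add (.var i) (.lit 1))))) τ
        (d * (K + 8) + 4) (Inv N) := by
    intro d
    induction d with
    | zero =>
      intro j hj τ hτ
      obtain ⟨h1, h2⟩ := hvars j τ hτ
      obtain rfl : j = N := by omega
      refine ⟨_, τ, .loop_done _ _ _ ?_ ?_, ?_, hτ⟩
      · simp only [Expr.Fits]
        omega
      · simp [Expr.eval, h1, h2]
      · simp [Expr.cost]
    | succ d ih =>
      intro j hj τ hτ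
      obtain ⟨h1, h2⟩ := hvars j τ hτ
      obtain ⟨k, ρ, h3, h4, h5, h6⟩ := hstep j (by omega) τ hτ
      obtain ⟨l, π, h7, h8, h9⟩ := ih (j + 1) (by omega) _ h6
      have hadd : (Expr.add (.var i) (.lit 1)).Fits W ρ := by
        simp only [Expr.Fits, Expr.eval]
        omega
      have hassign := Exec.assign (W := W) i (.add (.var i) (.lit 1)) ρ hadd
      have heval : (Expr.add (.var i) (.lit 1)).eval ρ = j + 1 := by simp [Expr.eval, h5]
      rw [heval] at hassign
      refine ⟨_, π, .loop_step _ _ _ _ _ _ _ ?_ ?_ (.seq _ _ _ _ _ _ _ h3 hassign) h7, ?_, h9⟩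
      · simp only [Expr.Fits]
        omega
      · simp only [Expr.eval, h1, h2, if_pos (show j < N by omega)]
        decide
      · simp only [Expr.cost]
        rw [Nat.succ_mul]
        omega
  refine ((runs_assign (Q := Inv 0) (x := i) (e := .lit 0) (by simp only [Expr.Fits]; omega)
    (by simpa [Expr.eval] using h0)).seq fun τ hτ => hloop N 0 (by omega) τ hτ).mono ?_
    fun _ h => h
  simp only [Expr.cost]
  omega

/-- `for v := 0, …, n - 1 do if c then a[v] := k`; the loop variable is variable `5`. -/
def Program.markLoop (a : ℕ) (c : Expr) (k : ℕ) : Program :=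
  .forLoop 5 0 (.branch c (.store a (.var 5) (.lit k)) .skip)

theorem runs_markLoop {a k n : ℕ} {c : Expr} (g : ℕ → Prop) [DecidablePred g] (hn : n < W)
    (hk : k < W) (hW : 1 < W) (hσ : σ.vars 0 = n)
    (hc : ∀ j < n, ∀ f, c.Fits W ((σ.setArr a f).setVar 5 j) ∧
      (c.eval ((σ.setArr a f).setVar 5 j) ≠ 0 ↔ g j))
    (hQ : Q ((σ.setArr a (fun i => if i < n ∧ g i then k else σ.arrs a i)).setVar 5 n)) :
    Runs W (.markLoop a c k) σ (n * (c.cost + 12) + 6) Q := by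
  refine (runs_forLoop (K := c.cost + 4) (N := n) (fun j τ => τ =
    (σ.setArr a (fun i => if i < j ∧ g i then k else σ.arrs a i)).setVar 5 j) hn hW
    ?_ ?_ ?_).mono (by rw [add_assoc]) (fun τ hτ => by rwa [hτ])
  · rintro j τ rfl
    simp [State.vars_setVar, hσ]
  · simp [State.setArr_self]
  · rintro j hj τ rfl
    obtain ⟨hfit, hval⟩ := hc j hj (fun i => if i < j ∧ g i then k else σ.arrs a i)
    refine runs_branch (K := 3) hfit (fun h => ?_) (fun h => ?_)
    · refine runs_store ?_ hk ⟨?_, ?_⟩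
      · simp only [Expr.Fits, State.vars_setVar, if_true]
        omega
      · simp [State.vars_setVar]
      · rw [State.setArr_setVar, State.setArr_setArr, State.setVar_setVar]
        congr 2
        funext i
        have hg := hval.1 h
        simp only [Expr.eval, State.vars_setVar, if_true, Function.update_apply, State.arrs_setVar,
          State.arrs_setArr]
        by_cases hi : i = j
        · subst hi
          simp [hg]
        · rw [if_neg hi]
          simp only [show i < j + 1 ↔ i < j by omega]
    · refine (runs_skip ⟨?_, ?_⟩).mono (by omega) fun _ h => h
      · simp [State.vars_setVar]
      · rw [State.setVar_setVar]
        congr 2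
        funext i
        have hg : ¬ g j := fun h' => hval.2 h' h
        by_cases hi : i = j
        · subst hi
          simp [hg]
        · simp only [show i < j + 1 ↔ i < j by omega]

/-- Search for an index `v` below variable `b` with `c`; the result is in variable `6`, which
is equal to variable `b` if there is none. -/
def Program.findLoop (b : ℕ) (c : Expr) : Program :=
  .seq (.assign 6 (.var b)) (.forLoop 5 b (.branch c (.assign 6 (.var 5)) .skip))

theorem runs_findLoop {b N : ℕ} {c : Expr} (g : ℕ → Prop) (hN : N < W) (hW : 1 < W)
    (hb5 : b ≠ 5) (hb6 : b ≠ 6) (hσ : σ.vars b = N)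
    (hc : ∀ j < N, ∀ u, c.Fits W ((σ.setVar 6 u).setVar 5 j) ∧
      (c.eval ((σ.setVar 6 u).setVar 5 j) ≠ 0 ↔ g j))
    (hQ : ∀ u, (u = N ∧ ∀ v < N, ¬ g v) ∨ (u < N ∧ g u) → Q ((σ.setVar 6 u).setVar 5 N)) :
    Runs W (.findLoop b c) σ (N * (c.cost + 11) + 8) Q := by
  refine ((runs_assign (Q := fun τ => τ = σ.setVar 6 N) (x := 6) (e := .var b)
    (by simp only [Expr.Fits]; omega) (by simp only [Expr.eval, hσ])).seq (fun τ hτ =>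
    runs_forLoop (K := c.cost + 3) (N := N) (fun j τ => ∃ u, τ = (σ.setVar 6 u).setVar 5 j ∧
      ((u = N ∧ ∀ v < j, ¬ g v) ∨ (u < N ∧ g u))) hN hW ?_ ?_ ?_)).mono ?_ ?_
  · rintro j τ ⟨u, rfl, -⟩
    simp [State.vars_setVar, hσ, hb5, hb6]
  · rw [hτ]
    exact ⟨N, rfl, .inl ⟨rfl, by simp⟩⟩
  · rintro j hj τ ⟨u, rfl, hu⟩
    obtain ⟨hfit, hval⟩ := hc j hj u
    refine runs_branch (K := 2) hfit (fun h => ?_) (fun h => ?_)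
    · refine runs_assign ?_ ⟨?_, j, ?_, .inr ⟨hj, hval.1 h⟩⟩
      · simp only [Expr.Fits, State.vars_setVar, if_true]
        omega
      · simp [State.vars_setVar]
      · simp only [Expr.eval, State.vars_setVar, if_true]
        rw [State.setVar_comm _ (by decide), State.setVar_setVar, State.setVar_comm _ (by decide),
          State.setVar_setVar, State.setVar_comm _ (by decide)]
    · refine (runs_skip ⟨?_, u, ?_, ?_⟩).mono (by omega) fun _ h => h
      · simp [State.vars_setVar]
      · rw [State.setVar_setVar]
      · refine hu.imp_left fun ⟨h1, h2⟩ => ⟨h1, fun v hv => ?_⟩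
        rcases Nat.lt_succ_iff_lt_or_eq.1 hv with hv | rfl
        · exact h2 v hv
        · exact fun h' => hval.2 h' h
  · simp only [Expr.cost]
    rw [show c.cost + 3 + 8 = c.cost + 11 by omega]
    omega
  · rintro τ ⟨u, rfl, hu⟩
    exact hQ u hu

end Rules

/-! ### Graph search on the machine -/

section Search

/-- The state of a graph search in `G - w` from the set `X` after `j` rounds: `R` is the set of the
vertices reached so far, `D` the set of those whose neighbours have been inspected. -/
structure SearchInv {n : ℕ} (G : SimpleGraph (Fin n)) (w : Fin n) (X R D : Set (Fin n)) (j : ℕ) :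
    Prop where
  subset : X ⊆ R
  notMem : w ∉ R
  reach : ∀ v ∈ R, ∃ x ∈ X, ReachAvoiding G w x v
  done_subset : D ⊆ R
  closed : ∀ u ∈ D, ∀ v, v ≠ w → G.Adj u v → v ∈ R
  progress : j ≤ D.ncard ∨ R ⊆ D

variable {n : ℕ} {G : SimpleGraph (Fin n)} {w : Fin n} {X R D : Set (Fin n)} {j : ℕ}

theorem searchInv_init (hw : w ∉ X) : SearchInv G w X X ∅ 0 where
  subset := subset_rfl
  notMem := hw
  reach v hv := ⟨v, hv, .nil, by
    rw [SimpleGraph.Walk.support_nil, List.mem_singleton]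
    rintro rfl
    exact hw hv⟩
  done_subset := Set.empty_subset _
  closed := by simp
  progress := .inl (Nat.zero_le _)

theorem SearchInv.idle (h : SearchInv G w X R D j) (hRD : R ⊆ D) :
    SearchInv G w X R D (j + 1) :=
  { h with progress := .inr hRD }

theorem SearchInv.step (h : SearchInv G w X R D j) {u : Fin n} (huR : u ∈ R) (huD : u ∉ D) :
    SearchInv G w X {v | v ≠ w ∧ (v ∈ R ∨ G.Adj u v)} (insert u D) (j + 1) where
  subset v hv := ⟨fun hvw => h.notMem (hvw ▸ h.subset hv), .inl (h.subset hv)⟩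
  notMem hw := hw.1 rfl
  reach := by
    rintro v ⟨hvw, hv | hv⟩
    · exact h.reach v hv
    · obtain ⟨x, hx, p, hp⟩ := h.reach u huR
      refine ⟨x, hx, p.concat hv, ?_⟩
      simp [SimpleGraph.Walk.support_concat, hp, hvw.symm]
  done_subset := by
    rintro v (rfl | hv)
    · exact ⟨fun hvw => h.notMem (hvw ▸ huR), .inl huR⟩
    · exact ⟨fun hvw => h.notMem (hvw ▸ h.done_subset hv), .inl (h.done_subset hv)⟩
  closed := by
    rintro x (rfl | hx) v hvw hxv
    · exact ⟨hvw, .inr hxv⟩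
    · exact ⟨hvw, .inl (h.closed x hx v hvw hxv)⟩
  progress := by
    left
    rw [Set.ncard_insert_of_notMem huD]
    rcases h.progress with h' | h'
    · omega
    · exact absurd (h' huR) huD

/-- After `n` rounds the search is complete, as `w` is never inspected. -/
theorem SearchInv.mem_iff (h : SearchInv G w X R D n) (v : Fin n) :
    v ∈ R ↔ ∃ x ∈ X, ReachAvoiding G w x v := by
  refine ⟨h.reach v, ?_⟩
  rintro ⟨x, hx, p, hp⟩
  have hRD : R ⊆ D := by
    refine h.progress.resolve_left fun hn => ?_
    have hcard : D.ncard = (Set.univ : Set (Fin n)).ncard := by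
      refine le_antisymm (Set.ncard_le_ncard (Set.subset_univ _)) ?_
      rwa [Set.ncard_univ, Nat.card_eq_fintype_card, Fintype.card_fin]
    have hD : D = Set.univ := Set.eq_of_subset_of_ncard_le (Set.subset_univ _) hcard.ge
    exact h.notMem (h.done_subset (hD ▸ Set.mem_univ w))
  have hxR := h.subset hx
  clear hx
  induction p with
  | nil => exact hxR
  | cons hxy p ih =>
    rw [SimpleGraph.Walk.support_cons, List.mem_cons, not_or] at hp
    refine ih hp.2 (h.closed _ (hRD hxR) _ ?_ hxy)
    rintro rfl
    exact hp.2 p.start_mem_support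

/-- What every part of the program relies on: the input is in place, the variables hold words, and
the arrays hold truth values. -/
structure InputContext (W n s t : ℕ) (A : ℕ → ℕ) (σ : State) : Prop where
  size : σ.vars 0 = n
  source : σ.vars 1 = s
  target : σ.vars 2 = t
  matrix : σ.arrs 0 = A
  vars_lt : ∀ x, σ.vars x < W
  arrs_le : ∀ a i, σ.arrs a i ≤ 1

variable {W s t : ℕ} {A : ℕ → ℕ} {σ : State}

theorem InputContext.setVar (h : InputContext W n s t A σ) {x v : ℕ} (hx : 3 ≤ x) (hv : v < W) :
    InputContext W n s t A (σ.setVar x v) where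
  size := by rw [State.vars_setVar, if_neg (by omega), h.size]
  source := by rw [State.vars_setVar, if_neg (by omega), h.source]
  target := by rw [State.vars_setVar, if_neg (by omega), h.target]
  matrix := h.matrix
  vars_lt y := by
    rw [State.vars_setVar]
    split_ifs
    · exact hv
    · exact h.vars_lt y
  arrs_le := h.arrs_le

theorem InputContext.setArr (h : InputContext W n s t A σ) {a : ℕ} {f : ℕ → ℕ} (ha : 1 ≤ a)
    (hf : ∀ i, f i ≤ 1) : InputContext W n s t A (σ.setArr a f) where
  size := h.size
  source := h.source
  target := h.target
  matrix := by rw [State.arrs_setArr, if_neg (by omega), h.matrix]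
  vars_lt := h.vars_lt
  arrs_le b i := by
    rw [State.arrs_setArr]
    split_ifs
    · exact hf i
    · exact h.arrs_le b i

theorem InputContext.update_le (h : InputContext W n s t A σ) {a i k : ℕ} (hk : k ≤ 1) :
    ∀ j, Function.update (σ.arrs a) i k j ≤ 1 := by
  intro j
  rw [Function.update_apply]
  split_ifs
  · exact hk
  · exact h.arrs_le a j

theorem InputContext.ite_le (h : InputContext W n s t A σ) {a k : ℕ} (hk : k ≤ 1) (p : ℕ → Prop)
    [DecidablePred p] : ∀ j, (if p j then k else σ.arrs a j) ≤ 1 := by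
  intro j
  split_ifs
  · exact hk
  · exact h.arrs_le a j

theorem index_lt {u v : ℕ} (hu : u < n) (hv : v < n) : u * n + v < n * n := by
  nlinarith

/-- One round of a graph search: array `2` marks the vertices that have been reached, array `3`
those whose neighbours have been inspected, and variable `3` is the deleted vertex, which the last
store takes out again if it is a neighbour of the inspected vertex. -/
def Program.searchRound : Program :=
  .seq (.findLoop 0 (.mul (.get 2 (.var 5)) (.sub (.lit 1) (.get 3 (.var 5)))))
    (.branch (.lt (.var 6) (.var 0))
      (.seq (.store 3 (.var 6) (.lit 1))
        (.seq (.markLoop 2 (.get 0 (.add (.mul (.var 6) (.var 0)) (.var 5))) 1)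
          (.store 2 (.var 3) (.lit 0))))
      .skip)

/-- Extend the set in array `2` by everything reachable from it when the vertex in variable `3` is
deleted. -/
def Program.search : Program :=
  .seq (.markLoop 3 (.lit 1) 0) (.forLoop 4 0 .searchRound)

theorem runs_searchRound (hW : n * n + n + 2 ≤ W)
    (hA : ∀ u v : Fin n, A (u * n + v) ≠ 0 ↔ G.Adj u v) (hσ : InputContext W n s t A σ)
    (hw : σ.vars 3 = w) (h : SearchInv G w X (σ.arrSet n 2) (σ.arrSet n 3) j) :
    Runs W .searchRound σ (36 * n + 24) (fun τ => InputContext W n s t A τ ∧ τ.vars 3 = w ∧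
      τ.vars 4 = σ.vars 4 ∧ τ.arrs 1 = σ.arrs 1 ∧
      SearchInv G w X (τ.arrSet n 2) (τ.arrSet n 3) (j + 1)) := by
  have hnW : n < W := by omega
  refine ((runs_findLoop (Q := fun τ => ∃ u, ((u = n ∧
    ∀ v < n, ¬ (σ.arrs 2 v ≠ 0 ∧ σ.arrs 3 v = 0)) ∨ (u < n ∧ (σ.arrs 2 u ≠ 0 ∧ σ.arrs 3 u = 0))) ∧
    τ = (σ.setVar 6 u).setVar 5 n)
    (fun v => σ.arrs 2 v ≠ 0 ∧ σ.arrs 3 v = 0) hnW (by omega) (by decide) (by decide)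
    hσ.size ?_ ?_).seq (L := 18 * n + 16) ?_).mono ?_ fun _ h => h
  · intro j hj u
    have h2 := hσ.arrs_le 2 j
    have h3 := hσ.arrs_le 3 j
    constructor
    · simp only [Expr.Fits, Expr.eval, State.vars_setVar, if_true, State.arrs_setVar]
      refine ⟨⟨by omega, by omega⟩, ⟨by omega, by omega, by omega⟩, ?_⟩
      have : σ.arrs 2 j * (1 - σ.arrs 3 j) ≤ 1 * 1 := Nat.mul_le_mul h2 (by omega)
      omega
    · simp only [Expr.eval, State.vars_setVar, if_true, State.arrs_setVar, ne_eq, mul_eq_zero,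
        not_or]
      omega
  · intro u hu
    exact ⟨u, hu, rfl⟩
  · rintro τ ⟨u, hu, rfl⟩
    have hu6 : ((σ.setVar 6 u).setVar 5 n).vars 6 = u := by simp [State.vars_setVar]
    have hun : u ≤ n := by omega
    have hτ : InputContext W n s t A ((σ.setVar 6 u).setVar 5 n) :=
      (hσ.setVar (by decide) (by omega)).setVar (by decide) (by omega)
    have hτ3 : ((σ.setVar 6 u).setVar 5 n).vars 3 = w := by simp [State.vars_setVar, hw]
    have hτ4 : ((σ.setVar 6 u).setVar 5 n).vars 4 = σ.vars 4 := by simp [State.vars_setVar]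
    have hτa : ((σ.setVar 6 u).setVar 5 n).arrs = σ.arrs := rfl
    generalize (σ.setVar 6 u).setVar 5 n = τ at hu6 hτ hτ3 hτ4 hτa
    refine (runs_branch (K := 18 * n + 12) ?_ (fun hlt => ?_) (fun hge => ?_)).mono ?_ fun _ h => h
    · exact ⟨hτ.vars_lt _, hτ.vars_lt _, by omega⟩
    · -- vertex `u` is inspected
      have hlt' : u < n := by
        by_contra hcon
        simp [Expr.eval, hu6, hτ.size, hcon] at hlt
      have hu' : σ.arrs 2 u ≠ 0 ∧ σ.arrs 3 u = 0 := by
        rcases hu with hu | hu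
        · omega
        · exact hu.2
      refine (((runs_store (Q := fun ρ => ρ = τ.setArr 3 (Function.update (τ.arrs 3) u 1))
        (i := .var 6) (e := .lit 1) (show _ < _ from hτ.vars_lt 6) (show 1 < W by omega)
        (by simp [Expr.eval, hu6])).seq (fun ρ hρ =>
        (runs_markLoop (n := n) (Q := fun π => ∃ f, π = (ρ.setArr 2 f).setVar 5 n ∧
          (∀ i, f i ≤ 1) ∧ ∀ v : Fin n, f v ≠ 0 ↔ (σ.arrs 2 v ≠ 0 ∨ G.Adj ⟨u, hlt'⟩ v))
          (fun i => A (u * n + i) ≠ 0) hnW (by omega) (by omega) ?_ ?_ ?_).seq (fun π hπ =>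
          runs_store (Q := _) ?_ ?_ ?_)))).mono ?_ fun _ h => h
      · rw [hρ]
        exact hτ.size
      · intro i hi f
        have hA1 : A (u * n + i) ≤ 1 := by
          have := hτ.arrs_le 0 (u * n + i)
          rwa [hτ.matrix] at this
        have hidx := index_lt hlt' hi
        have hidx' : u * n ≤ u * n + i := Nat.le_add_right _ _
        subst hρ
        simp [Expr.Fits, Expr.eval, State.vars_setVar, State.arrs_setArr, hu6, hτ.size, hτ.matrix]
        omega
      · have hρ2 : ρ.arrs 2 = σ.arrs 2 := by simp [hρ, State.arrs_setArr, hτa]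
        refine ⟨_, rfl, ?_, ?_⟩
        · rw [hρ2]
          exact hσ.ite_le le_rfl _
        · intro v
          rw [hρ2, ← hA ⟨u, hlt'⟩ v]
          split_ifs with hv
          · simpa using .inr hv.2
          · have : ¬ A (u * n + v) ≠ 0 := fun h' => hv ⟨v.2, h'⟩
            simp only [this, or_false]
      · obtain ⟨f, rfl, -⟩ := hπ
        subst hρ
        exact ((hτ.setArr (a := 3) (by decide) (hτ.update_le (a := 3) (i := u) le_rfl)).setVar
          (x := 5) (by decide) hnW).vars_lt 3
      · show 0 < W
        omega
      · obtain ⟨f, rfl, hf1, hf⟩ := hπ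
        subst hρ
        have hw3 : (Expr.var 3).eval (((τ.setArr 3 (Function.update (τ.arrs 3) u 1)).setArr 2
            f).setVar 5 n) = w := by
          simp [Expr.eval, State.vars_setVar, hτ3]
        rw [hw3]
        have hctx := ((hτ.setArr (a := 3) (by decide)
          (hτ.update_le (a := 3) (i := u) le_rfl)).setArr (a := 2) (by decide) hf1).setVar
          (x := 5) (by decide) hnW
        refine ⟨hctx.setArr (by decide) (hctx.update_le (Nat.zero_le _)), ?_, ?_, ?_, ?_⟩
        · simp [State.vars_setVar, hτ3]
        · simp [State.vars_setVar, hτ4]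
        · simp [State.arrs_setArr, hτa]
        · convert h.step (u := ⟨u, hlt'⟩) hu'.1 (by simpa [State.arrSet] using hu'.2) using 1
          · ext v
            simp only [State.arrSet, State.arrs_setArr, State.arrs_setVar, if_true,
              Set.mem_ofPred_eq, Function.update_apply, Fin.val_inj, Expr.eval]
            by_cases hvw : v = w
            · simp [hvw]
            · simp [hvw, hf v]
          · ext v
            simp only [State.arrSet, State.arrs_setArr, State.arrs_setVar, if_true, hτa,
              Set.mem_ofPred_eq, Set.mem_insert_iff, Fin.ext_iff]
            by_cases hvu : (v : ℕ) = u
            · simp [hvu]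
            · simp [hvu]
      · simp only [Expr.cost]
        omega
    · have hun' : ¬ u < n := by
        intro hcon
        simp [Expr.eval, hu6, hτ.size, hcon] at hge
      refine (runs_skip ⟨hτ, hτ3, hτ4, by rw [hτa], ?_⟩).mono (by omega) fun _ h => h
      have hidle := h.idle (fun v hv => by
        rcases hu with ⟨-, hu⟩ | hu
        · exact fun h0 => hu v v.2 ⟨hv, h0⟩
        · exact absurd hu.1 hun')
      simpa only [State.arrSet, hτa] using hidle
    · simp only [Expr.cost]
      omega
  · simp only [Expr.cost]
    omega

theorem runs_search (hW : n * n + n + 2 ≤ W)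
    (hA : ∀ u v : Fin n, A (u * n + v) ≠ 0 ↔ G.Adj u v) (hσ : InputContext W n s t A σ)
    (hw : σ.vars 3 = w) (hwX : σ.arrs 2 w = 0) :
    Runs W .search σ (36 * n ^ 2 + 45 * n + 12) (fun τ => InputContext W n s t A τ ∧
      τ.vars 3 = w ∧ τ.arrs 1 = σ.arrs 1 ∧
      ∀ v : Fin n, τ.arrs 2 v ≠ 0 ↔ ∃ x : Fin n, σ.arrs 2 x ≠ 0 ∧ ReachAvoiding G w x v) := by
  have hnW : n < W := by omega
  refine ((runs_markLoop (n := n) (Q := fun τ => InputContext W n s t A τ ∧ τ.vars 3 = w ∧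
    τ.arrs 1 = σ.arrs 1 ∧ τ.arrSet n 2 = σ.arrSet n 2 ∧ τ.arrSet n 3 = ∅)
    (fun _ => True) hnW (by omega) (by omega) hσ.size ?_ ?_).seq (fun τ hτ =>
    runs_forLoop (σ := τ) (K := 36 * n + 24) (N := n) (fun j ρ => InputContext W n s t A ρ ∧
      ρ.vars 3 = w ∧ ρ.vars 4 = j ∧ ρ.arrs 1 = σ.arrs 1 ∧
      SearchInv G w (σ.arrSet n 2) (ρ.arrSet n 2) (ρ.arrSet n 3) j)
      hnW (by omega) ?_ ?_ ?_)).mono ?_ ?_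
  · intro j hj f
    simp [Expr.Fits, Expr.eval]
    omega
  · refine ⟨(hσ.setArr (by decide) (hσ.ite_le (Nat.zero_le _) _)).setVar (by decide) hnW,
      ?_, ?_, ?_, ?_⟩
    · simp [State.vars_setVar, hw]
    · simp [State.arrs_setArr]
    · simp [State.arrSet, State.arrs_setArr]
    · ext v
      simp [State.arrSet, State.arrs_setArr]
  · rintro j ρ ⟨h1, -, h2, -⟩
    exact ⟨h2, h1.size⟩
  · obtain ⟨h1, h2, h3, h4, h5⟩ := hτ
    refine ⟨h1.setVar (by decide) (by omega), ?_, ?_, h3, ?_⟩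
    · simp [State.vars_setVar, h2]
    · simp [State.vars_setVar]
    · have := searchInv_init (G := G) (X := σ.arrSet n 2) (w := w)
        (by simpa [State.arrSet] using hwX)
      rw [← h5] at this
      nth_rw 2 [← h4] at this
      exact this
  · rintro j hj ρ ⟨h1, h2, h3, h4, h5⟩
    refine (runs_searchRound hW hA h1 h2 h5).mono le_rfl ?_
    rintro π ⟨g1, g2, g3, g4, g5⟩
    refine ⟨g3.trans h3, g1.setVar (by decide) (by omega), ?_, ?_, g4.trans h4, g5⟩
    · simp [State.vars_setVar, g2]
    · simp [State.vars_setVar]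
  · simp only [Expr.cost]
    nlinarith
  · rintro τ ⟨h1, h2, -, h3, h4⟩
    exact ⟨h1, h2, h3, h4.mem_iff⟩

end Search

/-! ### The marking program -/

section Main

variable {n : ℕ} {G : SimpleGraph (Fin n)} {W : ℕ} {A : ℕ → ℕ} {σ : State} {s t w : Fin n}

/-- Assignment of a truth value to the cell of a vertex that is held by a variable. -/
theorem runs_storeVertex {Q : State → Prop} {a x k : ℕ} {z : Fin n} (hW : n * n + n + 2 ≤ W)
    (hσ : InputContext W n s t A σ) (hx : σ.vars x = z) (ha : 1 ≤ a) (hk : k ≤ 1)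
    (hQ : ∀ τ, InputContext W n s t A τ → τ.vars = σ.vars → (∀ b, b ≠ a → τ.arrs b = σ.arrs b) →
      (∀ v : Fin n, τ.arrs a v = if v = z then k else σ.arrs a v) → Q τ) :
    Runs W (.store a (.var x) (.lit k)) σ 3 Q := by
  refine runs_store (i := .var x) (e := .lit k) (show _ < _ from hσ.vars_lt x)
    (show k < W by omega) (hQ _ (hσ.setArr ha (hσ.update_le hk)) rfl ?_ ?_)
  · intro b hb
    rw [State.arrs_setArr, if_neg hb]
  · intro v
    rw [State.arrs_setArr, if_pos rfl, Function.update_apply]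
    simp only [Expr.eval, hx, Fin.val_inj]

/-- Add the vertex of variable `x` to the set in array `2`, and close the set under reachability
in `G - w`, where `w` is held by variable `3`. -/
def Program.searchFrom (x : ℕ) : Program :=
  .seq (.store 2 (.var x) (.lit 1)) (.seq (.store 2 (.var 3) (.lit 0)) .search)

theorem runs_searchFrom {x : ℕ} {z : Fin n} (hW : n * n + n + 2 ≤ W)
    (hA : ∀ u v : Fin n, A (u * n + v) ≠ 0 ↔ G.Adj u v) (hσ : InputContext W n s t A σ)
    (hw : σ.vars 3 = w) (hx : σ.vars x = z) :
    Runs W (.searchFrom x) σ (36 * n ^ 2 + 45 * n + 18) (fun τ => InputContext W n s t A τ ∧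
      τ.vars 3 = w ∧ τ.arrs 1 = σ.arrs 1 ∧ ∀ v : Fin n, τ.arrs 2 v ≠ 0 ↔
        ReachAvoiding G w z v ∨ ∃ u : Fin n, σ.arrs 2 u ≠ 0 ∧ ReachAvoiding G w u v) := by
  refine (Runs.seq (L := 36 * n ^ 2 + 45 * n + 15) (runs_storeVertex (a := 2) hW hσ hx
    (by decide) le_rfl fun τ₁ c1 v1 a1 r1 => ?_) fun τ h => h).mono (by omega) fun _ h => h
  rw [← v1] at hw
  refine (Runs.seq (L := 36 * n ^ 2 + 45 * n + 12) (runs_storeVertex (a := 2) hW c1 hw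
    (by decide) (Nat.zero_le _) fun τ₂ c2 v2 a2 r2 => ?_) fun τ h => h).mono (by omega) fun _ h => h
  rw [← v2] at hw
  have hmem : ∀ v : Fin n, τ₂.arrs 2 v ≠ 0 ↔ v ≠ w ∧ (v = z ∨ σ.arrs 2 v ≠ 0) := by
    intro v
    rw [r2, r1]
    split_ifs <;> simp_all
  refine (runs_search hW hA c2 hw (by simpa using (hmem w).not)).mono le_rfl ?_
  rintro τ ⟨c3, w3, o3, r3⟩
  refine ⟨c3, w3, by rw [o3, a2 1 (by decide), a1 1 (by decide)], fun v => ?_⟩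
  rw [r3]
  constructor
  · rintro ⟨u, hu, huv⟩
    rcases ((hmem u).1 hu).2 with rfl | hu
    · exact .inl huv
    · exact .inr ⟨u, hu, huv⟩
  · rintro (h | ⟨u, hu, huv⟩)
    · exact ⟨z, (hmem z).2 ⟨h.ne_left.symm, .inl rfl⟩, h⟩
    · exact ⟨u, (hmem u).2 ⟨huv.ne_left.symm, .inr hu⟩, huv⟩

/-- Unmark the vertices that the vertex `w` of variable `3` excludes: `w` itself if `t` is not
reachable from `s` in `G - w`, and all other vertices that are reachable neither from `s` nor
from `t` in `G - w`. The second search goes on from the result of the first. The sum of the two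
comparisons in the last loop is nonzero if and only if its vertex is not `w`. -/
def Program.excludeVertices : Program :=
  .seq (.seq (.markLoop 2 (.lit 1) 0) (.searchFrom 1))
  (.seq (.branch (.get 2 (.var 2)) .skip (.store 1 (.var 3) (.lit 0)))
  (.seq (.searchFrom 2)
    (.markLoop 1 (.mul (.sub (.lit 1) (.get 2 (.var 5)))
      (.add (.lt (.var 3) (.var 5)) (.lt (.var 5) (.var 3)))) 0)))

/-- The vertex `w` does not exclude `v` from the marked set. -/
def Permits (G : SimpleGraph (Fin n)) (s t w v : Fin n) : Prop :=
  (v = w → ReachAvoiding G w s t) ∧ (v ≠ w → ReachAvoiding G w s v ∨ ReachAvoiding G w t v)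

theorem runs_excludeVertices (hW : n * n + n + 2 ≤ W)
    (hA : ∀ u v : Fin n, A (u * n + v) ≠ 0 ↔ G.Adj u v) (hσ : InputContext W n s t A σ)
    (hw : σ.vars 3 = w) :
    Runs W .excludeVertices σ (72 * n ^ 2 + 127 * n + 54) (fun τ => InputContext W n s t A τ ∧
      τ.vars 3 = w ∧ ∀ v : Fin n, τ.arrs 1 v ≠ 0 ↔ σ.arrs 1 v ≠ 0 ∧ Permits G s t w v) := by
  have hnW : n < W := by omega
  have hclear : Runs W (.markLoop 2 (.lit 1) 0) σ (13 * n + 6) (fun τ =>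
      InputContext W n s t A τ ∧ τ.vars 3 = w ∧ τ.arrs 1 = σ.arrs 1 ∧
      ∀ v : Fin n, τ.arrs 2 v = 0) := by
    refine (runs_markLoop (n := n) (fun _ => True) hnW (by omega) (by omega) hσ.size ?_ ?_).mono
      (by simp only [Expr.cost]; omega) fun _ h => h
    · intro j hj f
      simp [Expr.Fits, Expr.eval]
      omega
    · refine ⟨(hσ.setArr (by decide) (hσ.ite_le (Nat.zero_le _) _)).setVar (by decide) hnW, ?_,
        ?_, ?_⟩
      · simp [State.vars_setVar, hw]
      · simp [State.arrs_setArr]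
      · simp [State.arrs_setArr]
  have hfrom : Runs W (.seq (.markLoop 2 (.lit 1) 0) (.searchFrom 1)) σ
      (36 * n ^ 2 + 58 * n + 24) (fun τ => InputContext W n s t A τ ∧ τ.vars 3 = w ∧
      τ.arrs 1 = σ.arrs 1 ∧ ∀ v : Fin n, τ.arrs 2 v ≠ 0 ↔ ReachAvoiding G w s v) := by
    refine (hclear.seq (L := 36 * n ^ 2 + 45 * n + 18) fun τ ⟨c1, w1, o1, r1⟩ =>
      (runs_searchFrom hW hA c1 w1 c1.source).mono le_rfl ?_).mono (by omega) fun _ h => h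
    rintro ρ ⟨c2, w2, o2, r2⟩
    exact ⟨c2, w2, o2.trans o1, fun v => by simp [r2, r1]⟩
  refine (hfrom.seq (L := 36 * n ^ 2 + 69 * n + 30) fun τ ⟨c1, w1, o1, r1⟩ => ?_).mono (by omega)
    fun _ h => h
  have hbranch : Runs W (.branch (.get 2 (.var 2)) .skip (.store 1 (.var 3) (.lit 0))) τ 6
      (fun ρ => InputContext W n s t A ρ ∧ ρ.vars 3 = w ∧ ρ.arrs 2 = τ.arrs 2 ∧
      ∀ v : Fin n, ρ.arrs 1 v ≠ 0 ↔ σ.arrs 1 v ≠ 0 ∧ (v = w → ReachAvoiding G w s t)) := by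
    refine (runs_branch (K := 3) ?_ (fun h => ?_) (fun h => ?_)).mono
      (by simp only [Expr.cost]; omega) fun _ h => h
    · exact ⟨c1.vars_lt _, lt_of_le_of_lt (c1.arrs_le _ _) (by omega)⟩
    · have hst : ReachAvoiding G w s t := (r1 t).1 (by simpa [Expr.eval, c1.target] using h)
      refine (runs_skip ⟨c1, w1, rfl, fun v => ?_⟩).mono (by omega) fun _ h => h
      simp [o1, hst]
    · have hst : ¬ ReachAvoiding G w s t := fun hst =>
        (r1 t).2 hst (by simpa [Expr.eval, c1.target] using h)
      refine runs_storeVertex hW c1 w1 (by decide) (Nat.zero_le _) fun ρ c2 v2 a2 r2 =>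
        ⟨c2, by rw [v2, w1], a2 2 (by decide), fun v => ?_⟩
      rw [r2, o1]
      split_ifs <;> simp_all
  refine (hbranch.seq (L := 36 * n ^ 2 + 69 * n + 24) fun ρ ⟨c2, w2, a2, r2⟩ => ?_).mono (by omega)
    fun _ h => h
  refine ((runs_searchFrom hW hA c2 w2 c2.target).seq (L := 24 * n + 6)
    fun π ⟨c3, w3, o3, r3⟩ => ?_).mono (by omega) fun _ h => h
  have hπ : ∀ v : Fin n, π.arrs 2 v ≠ 0 ↔ ReachAvoiding G w s v ∨ ReachAvoiding G w t v := by
    intro v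
    rw [r3, a2]
    constructor
    · rintro (h | ⟨u, hu, huv⟩)
      · exact .inr h
      · exact .inl (((r1 u).1 hu).trans huv)
    · rintro (h | h)
      · exact .inr ⟨v, (r1 v).2 h, .nil, by simpa using h.ne_right⟩
      · exact .inl h
  refine (runs_markLoop (n := n) (fun v => π.arrs 2 v = 0 ∧ v ≠ w) hnW (by omega) (by omega)
    c3.size ?_ ?_).mono (by simp only [Expr.cost]; omega) fun _ h => h
  · intro j hj f
    have hle := c3.arrs_le 2 j
    have hww := w.2
    constructor
    · simp only [Expr.Fits, Expr.eval, State.vars_setVar, State.vars_setArr, State.arrs_setVar,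
        State.arrs_setArr, w3]
      norm_num
      split_ifs <;> omega
    · simp only [Expr.eval, State.vars_setVar, State.vars_setArr, State.arrs_setVar,
        State.arrs_setArr, w3]
      norm_num
      omega
  · refine ⟨(c3.setArr (by decide) (c3.ite_le (Nat.zero_le _) _)).setVar (by decide) hnW, ?_,
      fun v => ?_⟩
    · simp [State.vars_setVar, w3]
    · have h1 := hπ v
      have h2 := r2 v
      rw [← o3] at h2
      simp only [State.arrs_setArr, State.arrs_setVar, if_true, Permits, Fin.val_inj, v.2,
        true_and, ne_eq] at *
      rw [← and_assoc, ← h2, ← h1]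
      split_ifs with h <;> tauto

/-- If the graph has an edge, mark all vertices and then unmark those that some vertex excludes;
the result is in array `1`. -/
def markingProgram : Program :=
  .seq (.assign 8 (.mul (.var 0) (.var 0)))
  (.seq (.findLoop 8 (.get 0 (.var 5)))
    (.branch (.lt (.var 6) (.var 8))
      (.seq (.markLoop 1 (.lit 1) 1) (.forLoop 3 0 .excludeVertices))
      .skip))

theorem runs_markAndExclude (hW : n * n + n + 2 ≤ W)
    (hA : ∀ u v : Fin n, A (u * n + v) ≠ 0 ↔ G.Adj u v) (hσ : InputContext W n s t A σ) :
    Runs W (.seq (.markLoop 1 (.lit 1) 1) (.forLoop 3 0 .excludeVertices)) σ (300 * n ^ 3)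
      (fun τ => ∀ v : Fin n, τ.arrs 1 v ≠ 0 ↔ ∀ w, Permits G s t w v) := by
  have hnW : n < W := by omega
  refine ((runs_markLoop (n := n) (Q := fun τ => InputContext W n s t A τ ∧
    ∀ v : Fin n, τ.arrs 1 v ≠ 0) (fun _ => True) hnW (by omega) (by omega) hσ.size ?_ ?_).seq
    fun τ ⟨c1, r1⟩ => runs_forLoop (N := n) (K := 72 * n ^ 2 + 127 * n + 54)
      (fun j ρ => InputContext W n s t A ρ ∧ ρ.vars 3 = j ∧
        ∀ v : Fin n, ρ.arrs 1 v ≠ 0 ↔ ∀ w : Fin n, (w : ℕ) < j → Permits G s t w v)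
      hnW (by omega) ?_ ?_ ?_).mono ?_ ?_
  · intro j hj f
    simp [Expr.Fits, Expr.eval]
    omega
  · refine ⟨(hσ.setArr (by decide) (hσ.ite_le le_rfl _)).setVar (by decide) hnW, ?_⟩
    simp [State.arrs_setArr]
  · rintro j ρ ⟨h1, h2, -⟩
    exact ⟨h2, h1.size⟩
  · refine ⟨c1.setVar (by decide) (by omega), by simp [State.vars_setVar], fun v => ?_⟩
    simpa using r1 v
  · rintro j hj ρ ⟨c2, w2, r2⟩
    refine (runs_excludeVertices (w := ⟨j, hj⟩) hW hA c2 w2).mono le_rfl ?_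
    rintro π ⟨c3, w3, r3⟩
    refine ⟨w3, c3.setVar (by decide) (by omega), by simp [State.vars_setVar], fun v => ?_⟩
    rw [State.arrs_setVar, r3, r2]
    constructor
    · rintro ⟨h1, h2⟩ w hw
      rcases Nat.lt_succ_iff_lt_or_eq.1 hw with hw | hw
      · exact h1 w hw
      · rwa [show w = ⟨j, hj⟩ from Fin.ext hw]
    · exact fun h => ⟨fun w hw => h w (by omega), h _ (Nat.lt_succ_self j)⟩
  · simp only [Expr.cost]
    have hn : 1 ≤ n := by have := s.2; omega
    have h1 : n ≤ n ^ 3 := Nat.le_self_pow (by decide) n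
    have h2 : n ^ 2 ≤ n ^ 3 := Nat.pow_le_pow_right hn (by decide)
    have h3 : n * (72 * n ^ 2 + 127 * n + 54 + 8) = 72 * n ^ 3 + 127 * n ^ 2 + 62 * n := by ring
    omega
  · rintro ρ ⟨-, -, h⟩ v
    rw [h]
    exact ⟨fun h w => h w w.2, fun h w _ => h w⟩

theorem inputState_matrix_ne_zero (G : SimpleGraph (Fin n)) (s t u v : Fin n) :
    (inputState G s t).arrs 0 (u * n + v) ≠ 0 ↔ G.Adj u v := by
  have hinj : ∀ u' v' : Fin n, (u : ℕ) * n + v = u' * n + v' → u = u' ∧ v = v' := by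
    intro u' v' h
    have hn : 0 < n := u.pos
    have h1 := congrArg (· / n) h
    have h2 := congrArg (· % n) h
    simp only [Nat.mul_comm _ n, Nat.mul_add_div hn, Nat.div_eq_of_lt v.2, Nat.div_eq_of_lt v'.2,
      Nat.mul_add_mod, Nat.mod_eq_of_lt v.2, Nat.mod_eq_of_lt v'.2, add_zero] at h1 h2
    exact ⟨Fin.ext h1, Fin.ext h2⟩
  simp only [inputState]
  constructor
  · intro h
    split_ifs at h with h'
    · obtain ⟨-, u', v', h1, h2⟩ := h'
      obtain ⟨rfl, rfl⟩ := hinj u' v' h1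
      exact h2
    · exact absurd rfl h
  · intro h
    rw [if_pos ⟨rfl, u, v, rfl, h⟩]
    decide

theorem inputContext_inputState (hW : n * n + n + 2 ≤ W) (G : SimpleGraph (Fin n))
    (s t : Fin n) : InputContext W n s t ((inputState G s t).arrs 0) (inputState G s t) where
  size := rfl
  source := rfl
  target := rfl
  matrix := rfl
  vars_lt x := by
    have := s.2
    have := t.2
    simp only [inputState]
    split_ifs <;> omega
  arrs_le a i := by
    simp only [inputState]
    split_ifs <;> omega

/-- Without edges nothing is marked. -/
theorem markedSet_eq_empty (h : ∀ u v : Fin n, ¬ G.Adj u v) : markedSet G s t = ∅ := by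
  ext x
  refine ⟨?_, fun h => h.elim⟩
  rintro ⟨a, b, hab, -⟩
  exact h a b ((reducedGraph G s t).adj_sub hab)

theorem runs_markingProgram (hG : IsChordal G) (hW : n * n + n + 2 ≤ W) :
    Runs W markingProgram (inputState G s t) (400 * (n ^ 2 + G.edgeSet.ncard * n ^ 3))
      (fun τ => outputSet n τ = markedSet G s t) := by
  have hnW : n < W := by omega
  have hnn : n * n < W := by omega
  have hn : 1 ≤ n := s.pos
  have hσ := inputContext_inputState hW G s t
  have hA := inputState_matrix_ne_zero G s t
  have hout : ∀ i, (inputState G s t).arrs 1 i = 0 := fun i => by simp [inputState]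
  generalize hAe : (inputState G s t).arrs 0 = A at hσ hA
  generalize inputState G s t = σ at hσ hout hAe
  refine ((runs_assign (Q := fun τ => τ = σ.setVar 8 (n * n)) (x := 8)
    (e := .mul (.var 0) (.var 0)) ?_ ?_).seq
    (L := 13 * n ^ 2 + 13 + 300 * (G.edgeSet.ncard * n ^ 3)) fun τ hτ => ?_).mono ?_ fun _ h => h
  · simp only [Expr.Fits, Expr.eval, hσ.size]
    omega
  · simp only [Expr.eval, hσ.size]
  · have hc1 : InputContext W n s t A τ := hτ ▸ hσ.setVar (by decide) (by omega)
    have h8 : τ.vars 8 = n * n := by simp [hτ, State.vars_setVar]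
    have ho : ∀ i, τ.arrs 1 i = 0 := by simpa [hτ] using hout
    clear hτ hσ hout hAe
    refine ((runs_findLoop (N := n * n) (Q := fun ρ => ∃ u, ((u = n * n ∧
      ∀ v < n * n, ¬ A v ≠ 0) ∨ (u < n * n ∧ A u ≠ 0)) ∧ ρ = (τ.setVar 6 u).setVar 5 (n * n))
      (fun v => A v ≠ 0) hnn (by omega) (by decide) (by decide) h8 ?_ fun u hu =>
        ⟨u, hu, rfl⟩).seq (L := 5 + 300 * (G.edgeSet.ncard * n ^ 3)) ?_).mono ?_ fun _ h => h
    · intro j hj u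
      have := hc1.arrs_le 0 j
      simp only [Expr.Fits, Expr.eval, State.vars_setVar, State.arrs_setVar, if_true]
      rw [hc1.matrix] at this ⊢
      refine ⟨⟨?_, ?_⟩, Iff.rfl⟩ <;> omega
    · rintro ρ ⟨u, hu, rfl⟩
      have hu6 : ((τ.setVar 6 u).setVar 5 (n * n)).vars 6 = u := by simp [State.vars_setVar]
      have hu8 : ((τ.setVar 6 u).setVar 5 (n * n)).vars 8 = n * n := by
        simp [State.vars_setVar, h8]
      have hc2 : InputContext W n s t A ((τ.setVar 6 u).setVar 5 (n * n)) :=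
        (hc1.setVar (by decide) (by omega)).setVar (by decide) hnn
      have hev : (Expr.lt (.var 6) (.var 8)).eval ((τ.setVar 6 u).setVar 5 (n * n)) =
          if u < n * n then 1 else 0 := by
        simp only [Expr.eval, hu6, hu8]
      refine (runs_branch (K := 1 + 300 * (G.edgeSet.ncard * n ^ 3)) ?_ (fun h => ?_)
        (fun h => ?_)).mono (by simp only [Expr.cost]; omega) fun _ h => h
      · exact ⟨hc2.vars_lt _, hc2.vars_lt _, by omega⟩
      · have hun : u < n * n ∧ A u ≠ 0 := by
          rw [hev] at h
          split_ifs at h with h'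
          · omega
          · exact absurd rfl h
        -- the entry found is an edge, which pays for the main part
        have hm : 1 ≤ G.edgeSet.ncard := by
          have h1 : u / n < n := Nat.div_lt_of_lt_mul hun.1
          have h2 : u % n < n := Nat.mod_lt _ hn
          have hadj : G.Adj ⟨u / n, h1⟩ ⟨u % n, h2⟩ := by
            rw [← hA]
            rw [Nat.div_add_mod']
            exact hun.2
          exact (Set.ncard_pos (Set.toFinite _)).2 ⟨s(_, _), hadj⟩
        refine (runs_markAndExclude hW hA hc2).mono ?_ fun ρ hρ => ?_
        · have : 1 * n ^ 3 ≤ G.edgeSet.ncard * n ^ 3 := Nat.mul_le_mul_right _ hm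
          omega
        · ext x
          rw [mem_markedSet_iff hG]
          refine (hρ x).trans ⟨fun h => ⟨(h x).1 rfl, fun w hw => (h w).2 hw.symm⟩, ?_⟩
          rintro ⟨h1, h2⟩ w
          exact ⟨by rintro rfl; exact h1, fun hw => h2 w hw.symm⟩
      · have hnone : ∀ v < n * n, ¬ A v ≠ 0 := by
          rcases hu with hu | hu
          · exact hu.2
          · rw [hev, if_pos hu.1] at h
            exact absurd h one_ne_zero
        refine (runs_skip ?_).mono (by omega) fun _ h => h
        rw [markedSet_eq_empty fun u v huv => hnone _ (index_lt u.2 v.2) ((hA u v).2 huv)]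
        ext v
        simp [outputSet, ho]
    · simp only [Expr.cost]
      have : n * n = n ^ 2 := (sq n).symm
      omega
  · simp only [Expr.cost]
    have : 1 ≤ n ^ 2 := Nat.one_le_pow _ _ hn
    omega

end Main
end TrackingPaths

theorem mainTheorem1 :
    (∀ (V : Type*) [Finite V] (G : SimpleGraph V) (s t : V), TrackingPaths.IsChordal G →
      TrackingPaths.IsMinimumTrackingSet G s t (TrackingPaths.markedSet G s t)) ∧
    ∃ (P : TrackingPaths.Program) (c C : ℕ),
      ∀ (n : ℕ) (G : SimpleGraph (Fin n)) (s t : Fin n), TrackingPaths.IsChordal G →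
        ∃ (k : ℕ) (σ : TrackingPaths.State),
          TrackingPaths.Exec ((n + 2) ^ c) P (TrackingPaths.inputState G s t) k σ ∧
          TrackingPaths.outputSet n σ = TrackingPaths.markedSet G s t ∧
          TrackingPaths.IsMinimumTrackingSet G s t (TrackingPaths.outputSet n σ) ∧
          k ≤ C * (n ^ 2 + G.edgeSet.ncard * n ^ 3) ∧
          (0 < G.edgeSet.ncard → k ≤ C * (G.edgeSet.ncard * n ^ 3)) := by
  -- all words are at most `n * n`, and `n ^ 2 ≤ m * n ^ 3` for `m ≥ 1` turns `400` into `800`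
  refine ⟨fun V _ G s t hG => TrackingPaths.isMinimumTrackingSet_markedSet hG,
    TrackingPaths.markingProgram, 2, 800, fun n G s t hG => ?_⟩
  obtain ⟨k, σ, h1, h2, h3⟩ := TrackingPaths.runs_markingProgram (W := (n + 2) ^ 2) (s := s)
    (t := t) hG (by nlinarith)
  refine ⟨k, σ, h1, h3, h3 ▸ TrackingPaths.isMinimumTrackingSet_markedSet hG, by omega,
    fun hm => ?_⟩
  have hn : 1 ≤ n := s.pos
  have hle : n ^ 2 ≤ n ^ 3 := Nat.pow_le_pow_right hn (by decide)
  have hle' : 1 * n ^ 3 ≤ G.edgeSet.ncard * n ^ 3 := Nat.mul_le_mul_right _ hm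
  omega
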